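/- **Setting.** Let $\mathcal S$ be a (measurable) state space, $\mathcal A$ a set of $K\ge 1$ actions, $\gamma\in[0,1)$, $L>0$ and $M\ge 0$. A call $\mathtt{oracle}(s,a)$ returns, independently of everything else, a pair $(R,Z)$ of a reward $R\in[0,1]$ and a next state $Z$, with a law depending on $(s,a)$. At each state $s$ there is a Bellman operator $F_s:\mathbb R^K\to\mathbb R$, with $F_s(x)$ jointly measurable in $(s,x)$. We assume one of the following. * (Entropy regularization.) For some $\lambda>0$, every $F_s$ is the smooth maximum $x\mapsto\lambda\log\sum_a e^{x_a/\lambda}$ or the smooth minimum $x\mapsto-\lambda\log\sum_a e^{-x_a/\lambda}$, with $L=1/\lambda$ and $M=\lambda\log K$. It is the smooth maximum everywhere in an MDP; in a two-player game it depends on whose turn it is. * (General operators.) Every $F_s$ is differentiable, $\nabla F_s\ge 0$, $0<\|\nabla F_s\|_1\le 1$, $|F_s(0)|\le M$, and $|F_s(x)-F_s(y)-(x-y)^{\mathsf T}\nabla F_s(y)|\le L\|x-y\|_2^2$ for all $x,y$. There is exactly one bounded measurable value function $V$ with $V(s)=F_s(Q_s)$, where $Q_s(a)=\mathbb E[R+\gamma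 V(Z)]$ and $(R,Z)\sim\mathtt{oracle}(s,a)$. **Algorithm.** Put $C=\frac{1+M}{1-\gamma}$, $\kappa=\frac{1-\sqrt\gamma}{KL}$ and $N(\epsilon)=\Big\lceil\frac{18(1+M)^2}{(1-\gamma)^4(1-\sqrt\gamma)^2}\cdot\frac{\log(2K/\delta')}{\epsilon^2}\Big\rceil$, and let $\ell$ be a clipping level. (If the formula for $N(\epsilon)$ is negative, read it as $0$; if $\gamma=0$, read $\epsilon/\sqrt\gamma$ as $+\infty$.) * $\mathtt{estimateQ}(s,\epsilon)$: for each action $a$, draw $N(\epsilon)$ independent samples of $R+\gamma v$, where $(R,Z)\leftarrow\mathtt{oracle}(s,a)$ and $v\leftarrow\mathtt{sampleV}(Z,\epsilon/\sqrt\gamma)$; return their mean, clipped to $[\ell,C]$. * $\mathtt{sampleV}(s,\epsilon)$: if $\epsilon\ge C$, return $0$. Otherwise, if $\epsilon\ge\kappa$, return $F_s(\mathtt{estimateQ}(s,\epsilon))$. Otherwise let $\hat Q\leftarrow\mathtt{estimateQ}(s,\sqrt{\kappa\epsilon})$, draw an action $A\sim\nabla F_s(\hat Q)/\|\nabla F_s(\hat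 Q)\|_1$, let $(R,Z)\leftarrow\mathtt{oracle}(s,A)$ and $v\leftarrow\mathtt{sampleV}(Z,\epsilon/\sqrt\gamma)$, and return $F_s(\hat Q)-\hat Q^{\mathsf T}\nabla F_s(\hat Q)+(R+\gamma v)\|\nabla F_s(\hat Q)\|_1$. (For entropy regularization $\|\nabla F_s\|_1=1$.) * $\mathtt{SmoothCruiser}(s,\epsilon,\delta')$: return $\hat V(s)=F_s(\mathtt{estimateQ}(s,\epsilon))$. The clipping level is $\ell=0$, which is allowed if $F_s(0)\ge0$ for all $s$ (in particular in every entropy-regularized MDP) or if $Q_s(a)\ge 0$ for all $s,a$; or it is $\ell=-C$, which is always allowed. **Theorem.** The number $n(\epsilon,\delta')$ of oracle calls made by $\mathtt{SmoothCruiser}(s,\epsilon,\delta')$ is deterministic and depends only on $K,\gamma,L,M,\epsilon,\delta'$. For every problem as above, every state $s$, every $\epsilon>0$ and every $0<\delta'<2K$, $$\mathbb P\big(|\hat V(s)-V(s)|>\epsilon\big)\le\delta'\,n(\epsilon,\delta').$$ Moreover, for all $\epsilon,\delta>0$ there is a $\delta'=\delta'(\epsilon,\delta)>0$, depending only on $\epsilon,\delta$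 and $K,\gamma,L,M$, such that for every problem as above and every state $s$ the output of $\mathtt{SmoothCruiser}(s,\epsilon,\delta')$ satisfies $$\mathbb P\big(|\hat V(s)-V(s)|>\epsilon\big)\le\delta ,$$ and such that for every fixed $\delta>0$ and every $c>0$, $n(\epsilon,\delta'(\epsilon,\delta))=O(1/\epsilon^{4+c})$ as $\epsilon\to0^+$. -/

import Mathlib

open MeasureTheory ProbabilityTheory Filter Topology Asymptotics

universe u

noncomputable section

/-! ## The environment, its Bellman operators and its value function -/

/-- A discounted planning problem with `K` actions on an arbitrary measurable state space `S`,
up to its discount factor.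
* `oracle (s, a)` is the joint law of the pair `(R, Z)` (reward, next state) that a call of the
  generative model with parameters `(s, a)` returns; rewards lie in `[0, 1]`.
* `F s` is the Bellman operator at the state `s`, a differentiable function on `ℝ^K`. -/
structure Env (S : Type u) [MeasurableSpace S] (K : ℕ) where
  oracle : Kernel (S × Fin K) (ℝ × S)
  markov : IsMarkovKernel oracle
  reward_mem : ∀ p, ∀ᵐ o ∂(oracle p), o.1 ∈ Set.Icc (0 : ℝ) 1
  F : S → (Fin K → ℝ) → ℝ
  measurable_F : Measurable (fun p : S × (Fin K → ℝ) => F p.1 p.2)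
  differentiable_F : ∀ s, Differentiable ℝ (F s)

/-- `x ↦ lam * log (∑ a, exp (x a / lam))`. For `lam > 0` this is the smooth maximum, and with
`-lam` in place of `lam` it is the smooth minimum `x ↦ -lam * log (∑ a, exp (-x a / lam))`. -/
def logSumExp {K : ℕ} (lam : ℝ) (x : Fin K → ℝ) : ℝ :=
  lam * Real.log (∑ a, Real.exp (x a / lam))

namespace Env

variable {S : Type u} [MeasurableSpace S] {K : ℕ}

/-- The `a`-th entry of the gradient of `F s` at `x`. -/
def grad (E : Env S K) (s : S) (x : Fin K → ℝ) (a : Fin K) : ℝ :=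
  fderiv ℝ (E.F s) x (Pi.single a 1)

/-- The `ℓ¹`-norm of the gradient of `F s` at `x`. -/
def gradNorm (E : Env S K) (s : S) (x : Fin K → ℝ) : ℝ := ∑ a, |E.grad s x a|

/-- Entropy regularization with temperature `lam`: at each state, the Bellman operator is the
smooth maximum or the smooth minimum. In an MDP it is the smooth maximum everywhere, in a
two-player game the choice depends on whose turn it is. -/
def IsEntropic (E : Env S K) (lam : ℝ) : Prop :=
  ∀ s, E.F s = logSumExp lam ∨ E.F s = logSumExp (-lam)

/-- General smooth Bellman operators: nonnegative gradients, with `ℓ¹`-norm in `(0, 1]`,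
`L`-smoothness with respect to the Euclidean norm, and `|F s 0| ≤ M`
(differentiability is part of `Env`). -/
structure IsSmooth (E : Env S K) (L M : ℝ) : Prop where
  grad_nonneg : ∀ s x a, 0 ≤ E.grad s x a
  gradNorm_pos : ∀ s x, 0 < E.gradNorm s x
  gradNorm_le : ∀ s x, E.gradNorm s x ≤ 1
  smooth : ∀ s x y,
    |E.F s x - E.F s y - ∑ a, (x a - y a) * E.grad s y a| ≤ L * ∑ a, (x a - y a) ^ 2
  abs_zero_le : ∀ s, |E.F s 0| ≤ M

/-- `Q_s(a) = 𝔼[R + γ V(Z)]` with `(R, Z)` an output of the oracle at `(s, a)`. -/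
def qValue (E : Env S K) (γ : ℝ) (V : S → ℝ) (s : S) (a : Fin K) : ℝ :=
  ∫ o, (o.1 + γ * V o.2) ∂(E.oracle (s, a))

/-- `V` is the value function: the bounded measurable solution of `V(s) = F_s(Q_s)`. -/
structure IsValue (E : Env S K) (γ : ℝ) (V : S → ℝ) : Prop where
  measurable : Measurable V
  bounded : ∃ B, ∀ s, |V s| ≤ B
  bellman : ∀ s, V s = E.F s (E.qValue γ V s)

lemma measurable_grad (E : Env S K) (a : Fin K) :
    Measurable (fun p : S × (Fin K → ℝ) => E.grad p.1 p.2 a) := by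
  have hm : ∀ n : ℕ, Measurable (fun p : S × (Fin K → ℝ) =>
      ((n : ℝ) + 1) * (E.F p.1 (p.2 + ((n : ℝ) + 1)⁻¹ • Pi.single a (1 : ℝ)) - E.F p.1 p.2)) := by
    intro n
    have h1 : Measurable (fun p : S × (Fin K → ℝ) =>
        (p.1, p.2 + ((n : ℝ) + 1)⁻¹ • (Pi.single a (1 : ℝ) : Fin K → ℝ))) := by fun_prop
    exact ((E.measurable_F.comp h1).sub E.measurable_F).const_mul _
  refine measurable_of_tendsto_metrizable hm (tendsto_pi_nhds.2 fun p => ?_)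
  have hd : HasFDerivAt (E.F p.1) (fderiv ℝ (E.F p.1) p.2) p.2 :=
    (E.differentiable_F p.1 p.2).hasFDerivAt
  have hc : Tendsto (fun n : ℕ => ‖((n : ℝ) + 1)‖) atTop atTop := by
    refine tendsto_norm_atTop_atTop.comp ?_
    exact tendsto_atTop_add_const_right _ _ tendsto_natCast_atTop_atTop
  have := hd.lim (Pi.single a (1 : ℝ)) (c := fun n : ℕ => ((n : ℝ) + 1)) hc
  simpa [grad] using this

lemma measurable_gradNorm (E : Env S K) :
    Measurable (fun p : S × (Fin K → ℝ) => E.gradNorm p.1 p.2) := by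
  unfold gradNorm
  exact Finset.measurable_sum _ fun a _ => (E.measurable_grad a).abs

/-- The law of an action drawn from `∇F_s(x) / ‖∇F_s(x)‖₁`, as a kernel in `(s, x)`. For entropy
regularization the `ℓ¹`-norm is `1`, and the action is drawn from `∇F_s(x)`. -/
def draw (E : Env S K) : Kernel (S × (Fin K → ℝ)) (Fin K) where
  toFun p := ∑ a, ENNReal.ofReal (E.grad p.1 p.2 a / E.gradNorm p.1 p.2) • Measure.dirac a
  measurable' := by
    refine Measure.measurable_of_measurable_coe _ fun s _ => ?_
    simp only [Measure.coe_finsetSum, Finset.sum_apply, Measure.smul_apply, smul_eq_mul]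
    exact Finset.measurable_sum _ fun a _ =>
      ((E.measurable_grad a).div E.measurable_gradNorm).ennreal_ofReal.mul_const _

end Env

/-! ## The parameters of the algorithm -/

/-- The parameters that the learner knows: the number `K` of actions, the discount factor `γ`, the
smoothness constant `L`, and the bound `M` on `|F_s(0)|`. -/
structure Params where
  K : ℕ
  γ : ℝ
  L : ℝ
  M : ℝ
  K_pos : 0 < K
  γ_nonneg : 0 ≤ γ
  γ_lt_one : γ < 1
  L_pos : 0 < L
  M_nonneg : 0 ≤ M

namespace Params

/-- The a-priori bound `(1 + M) / (1 - γ)` on the values. -/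
def cap (P : Params) : ℝ := (1 + P.M) / (1 - P.γ)

/-- The threshold `κ = (1 - √γ) / (K L)`. -/
def kappa (P : Params) : ℝ := (1 - √P.γ) / (P.K * P.L)

/-- The number of samples per action. -/
def N (P : Params) (δ' ε : ℝ) : ℕ :=
  ⌈18 * (1 + P.M) ^ 2 / ((1 - P.γ) ^ 4 * (1 - √P.γ) ^ 2) * (Real.log (2 * P.K / δ') / ε ^ 2)⌉₊

/-- The accuracy `ε / √γ` of the recursive calls. For `γ = 0` it is infinite; it is replaced by
`cap` then, which is equivalent, as all accuracies `≥ cap` are treated in the same way. -/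
def relax (P : Params) (ε : ℝ) : ℝ := if P.γ = 0 then P.cap else ε / √P.γ

/-- A bound on the depth of the recursion; it serves only to show that the recursion ends. -/
def depth (P : Params) (ε : ℝ) : ℕ :=
  if ε < P.cap then ⌈Real.log (P.cap / ε) / Real.log (1 / √P.γ)⌉₊ + 1 else 0

lemma depth_lt (P : Params) {ε e : ℝ} (hε : 0 < ε) (hc : ε < P.cap) (he : ε ≤ e) :
    P.depth (P.relax e) < P.depth ε := by
  have hd : P.depth ε = ⌈Real.log (P.cap / ε) / Real.log (1 / √P.γ)⌉₊ + 1 := by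
    simp [depth, hc]
  rw [hd]
  by_cases h0 : P.γ = 0
  · simp [relax, depth, h0]
  have hγ : 0 < P.γ := lt_of_le_of_ne P.γ_nonneg (Ne.symm h0)
  have hs : 0 < √P.γ := Real.sqrt_pos.2 hγ
  have hs1 : √P.γ < 1 := by
    rw [Real.sqrt_lt' one_pos]; simpa using P.γ_lt_one
  have hr : P.relax e = e / √P.γ := by simp [relax, h0]
  rw [hr]
  unfold depth
  split_ifs with h
  · have hepos : 0 < e := hε.trans_le he
    have hcap : 0 < P.cap := hε.trans hc
    have ht : 0 < Real.log (1 / √P.γ) := Real.log_pos (by rw [lt_div_iff₀ hs]; simpa using hs1)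
    have h1 : Real.log (P.cap / (e / √P.γ)) + Real.log (1 / √P.γ) ≤ Real.log (P.cap / ε) := by
      rw [← Real.log_mul (by positivity) (by positivity)]
      refine Real.log_le_log (by positivity) ?_
      have : P.cap / (e / √P.γ) * (1 / √P.γ) = P.cap / e := by field_simp
      rw [this]
      gcongr
    have h2 : 0 < Real.log (P.cap / (e / √P.γ)) :=
      Real.log_pos (by rw [lt_div_iff₀ (by positivity)]; simpa using h)
    have h3 : Real.log (P.cap / (e / √P.γ)) / Real.log (1 / √P.γ) + 1
        ≤ Real.log (P.cap / ε) / Real.log (1 / √P.γ) := by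
      rw [div_add_one ht.ne']
      gcongr
    have h4 := Nat.ceil_mono h3
    rw [Nat.ceil_add_one (by positivity)] at h4
    omega
  · omega

lemma le_sqrt_kappa (P : Params) {ε : ℝ} (hε : 0 < ε) (h : ε < P.kappa) :
    ε ≤ √(P.kappa * ε) :=
  Real.le_sqrt_of_sq_le (by nlinarith)

end Params

/-! ## The algorithm

All procedures are kernels: they map their input to the joint law of their output and of the number
of oracle calls made on the way. -/

open Classical in
/-- Independent draws from the Markov kernels `κ i`, one for each `i` in a finite set. -/
def indepKernel {S X ι : Type*} [MeasurableSpace S] [MeasurableSpace X] [Fintype ι]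
    (κ : ι → Kernel S X) : Kernel S (ι → X) :=
  if h : ∀ i, IsMarkovKernel (κ i) then
    { toFun := fun s => Measure.pi fun i => κ i s
      measurable' := by
        have := h
        refine Measurable.measure_of_isPiSystem_of_isProbabilityMeasure generateFrom_pi.symm
          isPiSystem_pi ?_
        rintro _ ⟨t, ht, rfl⟩
        simp only [Measure.pi_pi]
        exact Finset.measurable_prod _ fun i _ =>
          Kernel.measurable_coe (κ i) (ht i (Set.mem_univ i)) }
  else 0

namespace Env

variable {S : Type u} [MeasurableSpace S] {K : ℕ}

/-- Call `(R, Z) ← oracle(s, a)`, then run the procedure `T` at `Z`, with output `v`; return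
`R + γ v`. The counter of `T` is increased by one for the oracle call. -/
def sampleQ (E : Env S K) (γ : ℝ) (T : Kernel S (ℝ × ℕ)) : Kernel (S × Fin K) (ℝ × ℕ) :=
  (E.oracle ⊗ₖ T.comap (fun p : (S × Fin K) × (ℝ × S) => p.2.2) (by fun_prop)).map
    fun p => (p.1.1 + γ * p.2.1, p.2.2 + 1)

variable (P : Params) (E : Env S P.K) (lo δ' : ℝ)

/-- `estimateQ(s, ε)`, where `T` is the procedure `sampleV(·, ε / √γ)` that it calls: for each
action `a`, average `N(ε)` independent samples of `R + γ v`, and clip the average to `[lo, cap]`.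
The original algorithm has `lo = 0`. -/
def estimateQ (T : Kernel S (ℝ × ℕ)) (ε : ℝ) : Kernel S ((Fin P.K → ℝ) × ℕ) :=
  (indepKernel fun i : Fin P.K × Fin (P.N δ' ε) =>
      (E.sampleQ P.γ T).comap (fun s => (s, i.1)) (by fun_prop)).map
    fun w => (fun a => min P.cap (max lo ((∑ k, (w (a, k)).1) / P.N δ' ε)), ∑ i, (w i).2)

/-- `sampleV(s, ε)`, for `ε > 0`. In the last case the output is
`F_s(Q̂) - Q̂ᵀ ∇F_s(Q̂) + (R + γ v) ‖∇F_s(Q̂)‖₁`; the last factor is `1` for entropy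
regularization. -/
def sampleV (ε : ℝ) : Kernel S (ℝ × ℕ) :=
  if _h : ε ≤ 0 ∨ P.cap ≤ ε then
    Kernel.const S (Measure.dirac (0, 0))
  else if _hκ : P.kappa ≤ ε then
    (Kernel.id ×ₖ estimateQ P E lo δ' (sampleV (P.relax ε)) ε).map
      fun p => (E.F p.1 p.2.1, p.2.2)
  else
    (((Kernel.id ×ₖ
          estimateQ P E lo δ' (sampleV (P.relax √(P.kappa * ε))) √(P.kappa * ε)) ⊗ₖ
        E.draw.comap (fun p : S × (S × ((Fin P.K → ℝ) × ℕ)) => (p.2.1, p.2.2.1))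
          (by fun_prop)) ⊗ₖ
      (E.sampleQ P.γ (sampleV (P.relax ε))).comap
        (fun p : S × ((S × ((Fin P.K → ℝ) × ℕ)) × Fin P.K) => (p.1, p.2.2)) (by fun_prop)).map
      fun p =>
        let s := p.1.1.1
        let Q := p.1.1.2.1
        (E.F s Q - ∑ a, Q a * E.grad s Q a + p.2.1 * E.gradNorm s Q, p.1.1.2.2 + p.2.2)
termination_by P.depth ε
decreasing_by
  · push Not at _h
    exact P.depth_lt _h.1 _h.2 le_rfl
  · push Not at _h _hκ
    exact P.depth_lt _h.1 _h.2 (P.le_sqrt_kappa _h.1 _hκ)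
  · push Not at _h
    exact P.depth_lt _h.1 _h.2 le_rfl

/-- `SmoothCruiser(s, ε, δ')`: the joint law of its output and of the number of oracle calls. -/
def smoothCruiser (ε : ℝ) : Kernel S (ℝ × ℕ) :=
  (Kernel.id ×ₖ estimateQ P E lo δ' (sampleV P E lo δ' (P.relax ε)) ε).map
    fun p => (E.F p.1 p.2.1, p.2.2)

/-- The problems covered: Bellman operators from entropy regularization with temperature `lam`,
where `L = 1 / lam` and `M = lam * log K`, or general smooth Bellman operators. -/
def Admissible : Prop :=
  (∃ lam : ℝ, 0 < lam ∧ P.L = 1 / lam ∧ P.M = lam * Real.log P.K ∧ E.IsEntropic lam) ∨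
    E.IsSmooth P.L P.M

/-- The lower clipping levels covered: the level `0` of the original algorithm when no operator is
negative at `0` (this includes every entropy-regularized MDP) or, more generally, when no `Q_s(a)`
is negative; and the level `-cap`, for every problem. Clipping at `0` is wrong when some `Q_s(a)`
is negative, which happens in entropy-regularized games. -/
def ClipLevel (V : S → ℝ) (lo : ℝ) : Prop :=
  (lo = 0 ∧ ((∀ s, 0 ≤ E.F s 0) ∨ ∀ s a, 0 ≤ E.qValue P.γ V s a)) ∨ lo = -P.cap

end Env

end

/-! ## Finite mixtures and the smooth maximum -/

/-! By Hoeffding's lemma the smooth maximum and minimum are smooth operators of the general kind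
(`IsEntropic.isSmooth`), so everything rests on `IsSmooth`. Gradients of `ℓ¹`-norm at most one make
each operator nonexpansive in the sup norm. Hence the Bellman equation is a `γ`-contraction, which
gives `V` and its a-priori bound `cap`.

Correctness: at accuracy `ε`, recursive calls contribute a bias `γ · ε/√γ = √γ ε`, which leaves `(1
- √γ) ε`. `estimateQ` spends this on the deviation of its empirical means. The linearized branch of
`sampleV` spends it on the Taylor remainder `L · K · κε` at an estimate of accuracy `√(κε)`; drawing
the action from the normalized gradient makes one sample unbiased for the linear part
(`accurate_linStep`). These bias bounds need accurate estimates, and conditioning on accuracy would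
distort the expectations. Each procedure is therefore compared with an ideal one, in which a bad
estimate is replaced by the true `Q`-values. Ideal procedures satisfy the bias bounds exactly.
`Near` measures the distance between the two laws; one correction costs at most `δ'` and costs add
up, so the total is at most `δ'` times the number of calls (`exists_accurate_sampleV`,
`smoothCruiser_error_le`).

Complexity: let `ℓ = log (2K/δ')`. Up to constants, the cost of `sampleV` obeys `c(ε) = (ℓ/ε)
c(√(κε)/√γ) + c(ε/√γ)`. The exponent 2 is critical, as `ε⁻¹ (√ε)⁻² = ε⁻²`; only factors `ℓ` and
constants accumulate, once per square root. The majorant `growth` absorbs them at the price of `ε ^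
(-2c)` and a small power of `1/δ'` (`exists_callsV_le_growth`). The outermost `estimateQ`
contributes another `ℓ/ε²`. Finally `δ'` is taken polynomial in `ε`, so a small power of `1/δ'` is a
small power of `1/ε` (`exists_confidence`). -/

lemma integral_sum_dirac {ι : Type*} [Fintype ι] [MeasurableSpace ι] [MeasurableSingletonClass ι]
    {p : ι → ℝ} (hp : ∀ a, 0 ≤ p a) (f : ι → ℝ) :
    ∫ x, f x ∂(∑ a, ENNReal.ofReal (p a) • Measure.dirac a) = ∑ a, p a * f a := by
  rw [integral_finsetSum_measure]
  · refine Finset.sum_congr rfl fun a _ => ?_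
    rw [integral_smul_measure, integral_dirac, ENNReal.toReal_ofReal (hp a), smul_eq_mul]
  · intro a _
    exact (integrable_dirac (by simp)).smul_measure ENNReal.ofReal_ne_top

lemma isProbabilityMeasure_sum_dirac {ι : Type*} [Fintype ι] [MeasurableSpace ι]
    {p : ι → ℝ} (hp : ∀ a, 0 ≤ p a) (h1 : ∑ a, p a = 1) :
    IsProbabilityMeasure (∑ a, ENNReal.ofReal (p a) • Measure.dirac a) := by
  constructor
  simp only [Measure.coe_finsetSum, Finset.sum_apply, Measure.smul_apply, smul_eq_mul,
    measure_univ, mul_one]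
  rw [← ENNReal.ofReal_sum_of_nonneg fun a _ => hp a, h1, ENNReal.ofReal_one]

lemma le_log_sum_mul_exp {K : ℕ} {p : Fin K → ℝ} (hp : ∀ a, 0 ≤ p a) (h1 : ∑ a, p a = 1)
    (v : Fin K → ℝ) : ∑ a, p a * v a ≤ Real.log (∑ a, p a * Real.exp (v a)) := by
  have key : Real.exp (∑ a, p a * v a) ≤ ∑ a, p a * Real.exp (v a) := by
    have := convexOn_exp.map_sum_le (t := Finset.univ) (w := p) (p := v) (fun a _ => hp a) h1
      (fun a _ => Set.mem_univ _)
    simpa using this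
  exact (Real.le_log_iff_exp_le ((Real.exp_pos _).trans_le key)).2 key

/-- Hoeffding's lemma: `v` takes values in `[-√W, √W]`, so its variance proxy is `W`. This would
even give `W / 2` for the last term. -/
lemma log_sum_mul_exp_le {K : ℕ} {p : Fin K → ℝ} (hp : ∀ a, 0 ≤ p a) (h1 : ∑ a, p a = 1)
    (v : Fin K → ℝ) :
    Real.log (∑ a, p a * Real.exp (v a)) ≤ ∑ a, p a * v a + ∑ a, v a ^ 2 := by
  have := isProbabilityMeasure_sum_dirac hp h1
  set μ : Measure (Fin K) := ∑ a, ENNReal.ofReal (p a) • Measure.dirac a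
  set W : ℝ := ∑ a, v a ^ 2
  have hW : 0 ≤ W := Finset.sum_nonneg fun a _ => sq_nonneg _
  have hv : ∀ a, v a ∈ Set.Icc (-√W) √W := fun a =>
    abs_le.1 (Real.abs_le_sqrt (Finset.single_le_sum (f := fun a => v a ^ 2)
      (fun a _ => sq_nonneg _) (Finset.mem_univ a)))
  have h := (hasSubgaussianMGF_of_mem_Icc (μ := μ) (X := v) (Measurable.of_discrete).aemeasurable
    (Filter.Eventually.of_forall hv)).mgf_le 1
  simp only [mgf, one_mul] at h
  have hm : ∫ a, v a ∂μ = ∑ a, p a * v a := integral_sum_dirac hp v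
  rw [hm, integral_sum_dirac hp] at h
  have hc : (((‖√W - -√W‖₊ / 2) ^ 2 : NNReal) : ℝ) = W := by
    push_cast
    rw [Real.norm_eq_abs, abs_of_nonneg (by have := Real.sqrt_nonneg W; linarith)]
    rw [show (√W - -√W) / 2 = √W by ring, Real.sq_sqrt hW]
  rw [hc] at h
  have hpos : 0 < ∑ a, p a * Real.exp (v a) := by
    have hne : ∃ a, p a ≠ 0 := by
      by_contra! h0
      simp [h0] at h1
    obtain ⟨a, ha⟩ := hne
    exact Finset.sum_pos' (fun a _ => mul_nonneg (hp a) (Real.exp_pos _).le)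
      ⟨a, Finset.mem_univ a, mul_pos (lt_of_le_of_ne (hp a) (Ne.symm ha)) (Real.exp_pos _)⟩
  rw [Real.log_le_iff_le_exp hpos]
  have h2 : ∑ a, p a * Real.exp (v a)
      = Real.exp (∑ a, p a * v a) * ∑ a, p a * Real.exp (v a - ∑ a, p a * v a) := by
    rw [Finset.mul_sum]
    refine Finset.sum_congr rfl fun a _ => ?_
    rw [Real.exp_sub]
    field_simp
  rw [h2, Real.exp_add]
  refine mul_le_mul_of_nonneg_left (h.trans (Real.exp_le_exp.2 ?_)) (Real.exp_pos _).le
  linarith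

section LogSumExp

variable {K : ℕ}

/-- The gradient of `logSumExp lam`. -/
noncomputable def softmax (lam : ℝ) (x : Fin K → ℝ) (a : Fin K) : ℝ :=
  Real.exp (x a / lam) / ∑ b, Real.exp (x b / lam)

lemma sum_exp_pos (hK : 0 < K) (x : Fin K → ℝ) : 0 < ∑ b, Real.exp (x b) :=
  Finset.sum_pos (fun _ _ => Real.exp_pos _) ⟨⟨0, hK⟩, Finset.mem_univ _⟩

lemma softmax_nonneg (lam : ℝ) (x : Fin K → ℝ) (a : Fin K) : 0 ≤ softmax lam x a :=
  div_nonneg (Real.exp_pos _).le (Finset.sum_nonneg fun _ _ => (Real.exp_pos _).le)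

lemma sum_softmax (hK : 0 < K) (lam : ℝ) (x : Fin K → ℝ) : ∑ a, softmax lam x a = 1 := by
  unfold softmax
  rw [← Finset.sum_div]
  exact div_self (sum_exp_pos hK fun b => x b / lam).ne'

lemma hasFDerivAt_logSumExp (hK : 0 < K) {lam : ℝ} (hl : lam ≠ 0) (x : Fin K → ℝ) :
    HasFDerivAt (logSumExp lam)
      (∑ a, softmax lam x a • ContinuousLinearMap.proj (R := ℝ) (φ := fun _ : Fin K => ℝ) a) x := by
  have h0 := sum_exp_pos hK fun b => x b / lam
  have h1 : ∀ a : Fin K, HasFDerivAt (fun y : Fin K → ℝ => Real.exp (y a / lam))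
      (Real.exp (x a / lam) • (lam⁻¹ •
        ContinuousLinearMap.proj (R := ℝ) (φ := fun _ : Fin K => ℝ) a)) x := by
    intro a
    have : HasFDerivAt (fun y : Fin K → ℝ => y a / lam)
        (lam⁻¹ • ContinuousLinearMap.proj (R := ℝ) (φ := fun _ : Fin K => ℝ) a) x := by
      simp_rw [div_eq_inv_mul]
      exact (ContinuousLinearMap.proj (R := ℝ) (φ := fun _ : Fin K => ℝ) a).hasFDerivAt.const_mul _
    exact this.exp
  have h2 := ((HasFDerivAt.fun_sum fun a (_ : a ∈ Finset.univ) => h1 a).log h0.ne').const_mul lam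
  refine h2.congr_fderiv ?_
  rw [Finset.smul_sum, Finset.smul_sum]
  refine Finset.sum_congr rfl fun a _ => ?_
  rw [smul_smul, smul_smul, smul_smul]
  congr 1
  unfold softmax
  field_simp

/-- With `p` the softmax at `y` and `v = (x - y) / lam`, the Taylor remainder is `lam * (log 𝔼ₚ[exp
v] - 𝔼ₚ[v])`, and the bracket lies in `[0, ∑ v²]` by Jensen and Hoeffding. Only `|lam|` matters, so
the smooth minimum is included. -/
lemma logSumExp_smooth (hK : 0 < K) {lam : ℝ} (hl : lam ≠ 0) (x y : Fin K → ℝ) :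
    |logSumExp lam x - logSumExp lam y - ∑ a, (x a - y a) * softmax lam y a| ≤
      1 / |lam| * ∑ a, (x a - y a) ^ 2 := by
  have hx := sum_exp_pos hK fun b => x b / lam
  have hy := sum_exp_pos hK fun b => y b / lam
  set v : Fin K → ℝ := fun a => (x a - y a) / lam with hv
  have h1 : ∑ a, softmax lam y a * Real.exp (v a)
      = (∑ b, Real.exp (x b / lam)) / ∑ b, Real.exp (y b / lam) := by
    rw [Finset.sum_div]
    refine Finset.sum_congr rfl fun a _ => ?_
    simp only [softmax, hv, sub_div, Real.exp_sub]
    field_simp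
  have hlo := le_log_sum_mul_exp (softmax_nonneg lam y) (sum_softmax hK lam y) v
  have hhi := log_sum_mul_exp_le (softmax_nonneg lam y) (sum_softmax hK lam y) v
  rw [h1, Real.log_div hx.ne' hy.ne'] at hlo hhi
  have h2 : logSumExp lam x - logSumExp lam y - ∑ a, (x a - y a) * softmax lam y a
      = lam * (Real.log (∑ b, Real.exp (x b / lam)) - Real.log (∑ b, Real.exp (y b / lam))
        - ∑ a, softmax lam y a * v a) := by
    have : ∑ a, (x a - y a) * softmax lam y a = lam * ∑ a, softmax lam y a * v a := by
      rw [Finset.mul_sum]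
      refine Finset.sum_congr rfl fun a _ => ?_
      simp only [hv]
      field_simp
    rw [this]
    unfold logSumExp
    ring
  have h3 : 1 / |lam| * ∑ a, (x a - y a) ^ 2 = |lam| * ∑ a, v a ^ 2 := by
    rw [Finset.mul_sum, Finset.mul_sum]
    refine Finset.sum_congr rfl fun a _ => ?_
    simp only [hv, div_pow]
    rw [← sq_abs lam]
    have := abs_pos.2 hl
    field_simp
  rw [h2, h3, abs_mul]
  refine mul_le_mul_of_nonneg_left ?_ (abs_nonneg _)
  rw [abs_of_nonneg (by linarith)]
  linarith

lemma logSumExp_zero (lam : ℝ) : logSumExp (K := K) lam 0 = lam * Real.log K := by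
  simp [logSumExp]

end LogSumExp

/-! ### Smooth Bellman operators: monotonicity and nonexpansiveness -/

namespace Env

variable {S : Type u} [MeasurableSpace S] {K : ℕ} {E : Env S K}

lemma grad_eq_softmax (hK : 0 < K) {lam : ℝ} (hl : lam ≠ 0) {s : S} (h : E.F s = logSumExp lam)
    (x : Fin K → ℝ) : E.grad s x = softmax lam x := by
  ext a
  rw [grad, h, (hasFDerivAt_logSumExp hK hl x).fderiv]
  simp [Pi.single_apply]

lemma IsEntropic.isSmooth (hK : 0 < K) {lam : ℝ} (hl : 0 < lam) (h : E.IsEntropic lam) :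
    E.IsSmooth (1 / lam) (lam * Real.log K) := by
  have h' : ∀ s, ∃ l : ℝ, l ≠ 0 ∧ |l| = lam ∧ E.F s = logSumExp l := fun s => by
    rcases h s with hs | hs
    · exact ⟨lam, hl.ne', abs_of_pos hl, hs⟩
    · exact ⟨-lam, neg_ne_zero.2 hl.ne', by rw [abs_neg, abs_of_pos hl], hs⟩
  have hn : ∀ s x, E.gradNorm s x = 1 := fun s x => by
    obtain ⟨l, hl0, -, hs⟩ := h' s
    rw [gradNorm, grad_eq_softmax hK hl0 hs, ← sum_softmax hK l x]
    exact Finset.sum_congr rfl fun a _ => abs_of_nonneg (softmax_nonneg l x a)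
  refine ⟨fun s x a => ?_, fun s x => ?_, fun s x => (hn s x).le, fun s x y => ?_, fun s => ?_⟩
  · obtain ⟨l, hl0, -, hs⟩ := h' s
    rw [grad_eq_softmax hK hl0 hs]
    exact softmax_nonneg l x a
  · rw [hn]; exact one_pos
  · obtain ⟨l, hl0, hla, hs⟩ := h' s
    rw [grad_eq_softmax hK hl0 hs, hs, ← hla]
    exact logSumExp_smooth hK hl0 x y
  · obtain ⟨l, hl0, hla, hs⟩ := h' s
    rw [hs, logSumExp_zero, abs_mul, hla, abs_of_nonneg (Real.log_natCast_nonneg K)]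

lemma Admissible.isSmooth {P : Params} {E : Env S P.K} (h : E.Admissible P) :
    E.IsSmooth P.L P.M := by
  rcases h with ⟨lam, hl, hL, hM, h⟩ | h
  · rw [hL, hM]
    exact h.isSmooth P.K_pos hl
  · exact h

namespace IsSmooth

variable {L M : ℝ}

lemma gradNorm_eq (h : E.IsSmooth L M) (s : S) (x : Fin K → ℝ) :
    E.gradNorm s x = ∑ a, E.grad s x a :=
  Finset.sum_congr rfl fun a _ => abs_of_nonneg (h.grad_nonneg s x a)

lemma abs_sum_mul_grad_le (h : E.IsSmooth L M) (s : S) (x v : Fin K → ℝ) {b : ℝ} (hb : 0 ≤ b)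
    (hv : ∀ a, |v a| ≤ b) : |∑ a, v a * E.grad s x a| ≤ b := by
  calc |∑ a, v a * E.grad s x a| ≤ ∑ a, |v a * E.grad s x a| := Finset.abs_sum_le_sum_abs _ _
    _ ≤ ∑ a, b * E.grad s x a := Finset.sum_le_sum fun a _ => by
        rw [abs_mul, abs_of_nonneg (h.grad_nonneg s x a)]
        exact mul_le_mul_of_nonneg_right (hv a) (h.grad_nonneg s x a)
    _ = b * E.gradNorm s x := by rw [h.gradNorm_eq, Finset.mul_sum]
    _ ≤ b := mul_le_of_le_one_right hb (h.gradNorm_le s x)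

end IsSmooth

/-- The mean value theorem on the segment from `y` to `x`. It turns the gradient conditions into
Lipschitz and order bounds. -/
lemma exists_sub_eq_sum_mul_grad (E : Env S K) (s : S) (x y : Fin K → ℝ) :
    ∃ z, E.F s x - E.F s y = ∑ a, (x a - y a) * E.grad s z a := by
  obtain ⟨z, -, hz⟩ := domain_mvt (f := E.F s) (s := Set.univ) (x := y) (y := x)
    (fun w _ => (E.differentiable_F s w).hasFDerivAt.hasFDerivWithinAt) convex_univ
    (Set.mem_univ _) (Set.mem_univ _)
  refine ⟨z, hz.trans ?_⟩
  conv_lhs => rw [← Finset.univ_sum_single (x - y)]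
  rw [map_sum]
  refine Finset.sum_congr rfl fun a _ => ?_
  have : Pi.single a ((x - y) a) = (x a - y a) • (Pi.single a (1 : ℝ) : Fin K → ℝ) := by
    rw [← Pi.single_smul]; simp
  rw [this, map_smul, smul_eq_mul, grad]

namespace IsSmooth

variable {L M : ℝ}

lemma abs_sub_le (h : E.IsSmooth L M) (s : S) {x y : Fin K → ℝ} {b : ℝ} (hb : 0 ≤ b)
    (hxy : ∀ a, |x a - y a| ≤ b) : |E.F s x - E.F s y| ≤ b := by
  obtain ⟨z, hz⟩ := E.exists_sub_eq_sum_mul_grad s x y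
  rw [hz]
  exact h.abs_sum_mul_grad_le s z (fun a => x a - y a) hb hxy

lemma abs_le (h : E.IsSmooth L M) (s : S) {x : Fin K → ℝ} {b : ℝ} (hb : 0 ≤ b)
    (hx : ∀ a, |x a| ≤ b) : |E.F s x| ≤ M + b := by
  have h1 := h.abs_sub_le s (x := x) (y := 0) hb (by simpa using hx)
  have h2 := h.abs_zero_le s
  calc |E.F s x| = |E.F s 0 + (E.F s x - E.F s 0)| := by ring_nf
    _ ≤ _ := (abs_add_le _ _).trans (add_le_add h2 h1)

/-- Nonnegative gradients let a one-sided bound on `x` suffice. This serves to justify clipping at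
`0`. -/
lemma sub_le_of_neg_le (h : E.IsSmooth L M) (s : S) {x : Fin K → ℝ} {b : ℝ} (hb : 0 ≤ b)
    (hx : ∀ a, -b ≤ x a) : E.F s 0 - b ≤ E.F s x := by
  obtain ⟨z, hz⟩ := E.exists_sub_eq_sum_mul_grad s x 0
  have h1 : ∑ a, -b * E.grad s z a ≤ ∑ a, (x a - (0 : Fin K → ℝ) a) * E.grad s z a :=
    Finset.sum_le_sum fun a _ =>
      mul_le_mul_of_nonneg_right (by simpa using hx a) (h.grad_nonneg s z a)
  rw [← Finset.mul_sum, ← h.gradNorm_eq] at h1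
  have h2 := mul_le_of_le_one_right hb (h.gradNorm_le s z)
  linarith

end IsSmooth

end Env

/-! ## The value function -/

namespace Params

variable (P : Params)

lemma one_sub_pos : 0 < 1 - P.γ := sub_pos.2 P.γ_lt_one

/-- A bound `B` on a function becomes `1 + M + γ B` under the Bellman operator; `cap` is the fixed
point. -/
lemma cap_eq : P.cap = 1 + P.M + P.γ * P.cap := by
  have := P.one_sub_pos
  unfold cap
  field_simp
  ring

lemma one_add_le_cap : 1 + P.M ≤ P.cap := by
  have := P.M_nonneg
  rw [cap, le_div_iff₀ P.one_sub_pos]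
  nlinarith [P.γ_nonneg]

lemma one_le_cap : 1 ≤ P.cap := by
  have := P.one_add_le_cap
  have := P.M_nonneg
  linarith

lemma cap_pos : 0 < P.cap := one_pos.trans_le P.one_le_cap

lemma sqrt_nonneg : 0 ≤ √P.γ := Real.sqrt_nonneg _

lemma sqrt_lt_one : √P.γ < 1 := by
  rw [Real.sqrt_lt' one_pos]
  simpa using P.γ_lt_one

end Params

namespace Env

variable {S : Type u} [MeasurableSpace S] {K : ℕ}

instance (E : Env S K) : IsMarkovKernel E.oracle := E.markov

section Q

variable (E : Env S K) {γ : ℝ} {V W : S → ℝ} {B : ℝ}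

lemma integrable_reward (p : S × Fin K) : Integrable (fun o => o.1) (E.oracle p) :=
  Integrable.of_mem_Icc 0 1 measurable_fst.aemeasurable (E.reward_mem p)

lemma integrable_comp_snd (hV : Measurable V) (hB : ∀ s, |V s| ≤ B) (p : S × Fin K) :
    Integrable (fun o => V o.2) (E.oracle p) :=
  Integrable.of_bound (hV.comp measurable_snd).aestronglyMeasurable B (Eventually.of_forall fun o => hB o.2)

lemma integrable_target (hV : Measurable V) (hB : ∀ s, |V s| ≤ B) (p : S × Fin K) :
    Integrable (fun o => o.1 + γ * V o.2) (E.oracle p) :=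
  (E.integrable_reward p).add ((E.integrable_comp_snd hV hB p).const_mul γ)

lemma abs_qValue_le (hγ : 0 ≤ γ) (hB : ∀ s, |V s| ≤ B) (s : S) (a : Fin K) :
    |E.qValue γ V s a| ≤ 1 + γ * B := by
  have h := norm_integral_le_of_norm_le_const (μ := E.oracle (s, a))
    (f := fun o => o.1 + γ * V o.2) (C := 1 + γ * B) (by
      filter_upwards [E.reward_mem (s, a)] with o ho
      calc ‖o.1 + γ * V o.2‖ ≤ |o.1| + |γ * V o.2| := abs_add_le _ _
        _ ≤ 1 + γ * B := by
          rw [abs_mul, abs_of_nonneg hγ, abs_of_nonneg ho.1]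
          exact add_le_add ho.2 (mul_le_mul_of_nonneg_left (hB _) hγ))
  simpa [qValue] using h

lemma qValue_ge (hγ : 0 ≤ γ) (hV : Measurable V) (hB : ∀ s, |V s| ≤ B) {b : ℝ}
    (hb : ∀ s, -b ≤ V s) (s : S) (a : Fin K) : -(γ * b) ≤ E.qValue γ V s a := by
  have h1 : ∫ _ : ℝ × S, -(γ * b) ∂(E.oracle (s, a)) ≤ E.qValue γ V s a := by
    refine integral_mono_ae (integrable_const _)
      (E.integrable_target hV hB _) ?_
    filter_upwards [E.reward_mem (s, a)] with o ho
    have := mul_le_mul_of_nonneg_left (hb o.2) hγ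
    have := ho.1
    linarith
  simpa using h1

lemma abs_qValue_sub_le (hγ : 0 ≤ γ) (hV : Measurable V) (hW : Measurable W)
    (hB : ∀ s, |V s| ≤ B) {B' : ℝ} (hB' : ∀ s, |W s| ≤ B') {d : ℝ} (hd : ∀ s, |V s - W s| ≤ d)
    (s : S) (a : Fin K) : |E.qValue γ V s a - E.qValue γ W s a| ≤ γ * d := by
  have h2 : E.qValue γ V s a - E.qValue γ W s a
      = ∫ o, γ * (V o.2 - W o.2) ∂(E.oracle (s, a)) := by
    unfold qValue
    rw [← integral_sub (E.integrable_target hV hB (s, a)) (E.integrable_target hW hB' (s, a))]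
    refine integral_congr_ae (Eventually.of_forall fun o => ?_)
    ring
  rw [h2]
  have h := norm_integral_le_of_norm_le_const (μ := E.oracle (s, a))
    (f := fun o => γ * (V o.2 - W o.2)) (C := γ * d) (Eventually.of_forall fun o => by
      rw [Real.norm_eq_abs, abs_mul, abs_of_nonneg hγ]
      exact mul_le_mul_of_nonneg_left (hd _) hγ)
  simpa using h

lemma measurable_qValue (hV : Measurable V) : Measurable (E.qValue γ V) := by
  refine measurable_pi_lambda _ fun a => ?_
  have h : StronglyMeasurable fun o : ℝ × S => o.1 + γ * V o.2 :=
    Measurable.stronglyMeasurable (by fun_prop)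
  have := (StronglyMeasurable.integral_kernel (κ := E.oracle) h).measurable
  exact this.comp (measurable_id.prodMk measurable_const)

lemma measurable_bellman (hV : Measurable V) : Measurable fun s => E.F s (E.qValue γ V s) :=
  E.measurable_F.comp (measurable_id.prodMk (E.measurable_qValue hV))

end Q

/-- Value iteration, started at `0`. -/
noncomputable def valueIter (E : Env S K) (γ : ℝ) : ℕ → S → ℝ
  | 0 => fun _ => 0
  | k + 1 => fun s => E.F s (E.qValue γ (E.valueIter γ k) s)

lemma measurable_valueIter (E : Env S K) (γ : ℝ) (k : ℕ) : Measurable (E.valueIter γ k) := by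
  induction k with
  | zero => exact measurable_const
  | succ k ih => exact E.measurable_bellman ih

variable {P : Params} {E : Env S P.K}

lemma abs_bellman_le (h : E.IsSmooth P.L P.M) {V : S → ℝ} {B : ℝ} (hB0 : 0 ≤ B)
    (hB : ∀ s, |V s| ≤ B) (s : S) : |E.F s (E.qValue P.γ V s)| ≤ 1 + P.M + P.γ * B := by
  have := h.abs_le s (b := 1 + P.γ * B) (by have := P.γ_nonneg; positivity)
    (E.abs_qValue_le P.γ_nonneg hB s)
  linarith

lemma abs_valueIter_le (h : E.IsSmooth P.L P.M) (k : ℕ) (s : S) :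
    |E.valueIter P.γ k s| ≤ P.cap := by
  induction k generalizing s with
  | zero => simpa [valueIter] using P.cap_pos.le
  | succ k ih =>
    rw [P.cap_eq]
    exact abs_bellman_le h P.cap_pos.le ih s

lemma abs_bellman_sub_le (h : E.IsSmooth P.L P.M) {V W : S → ℝ} (hV : Measurable V)
    (hW : Measurable W) {B B' : ℝ} (hB : ∀ s, |V s| ≤ B) (hB' : ∀ s, |W s| ≤ B') {d : ℝ}
    (hd0 : 0 ≤ d) (hd : ∀ s, |V s - W s| ≤ d) (s : S) :
    |E.F s (E.qValue P.γ V s) - E.F s (E.qValue P.γ W s)| ≤ P.γ * d :=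
  h.abs_sub_le s (mul_nonneg P.γ_nonneg hd0)
    (E.abs_qValue_sub_le P.γ_nonneg hV hW hB hB' hd s)

lemma abs_valueIter_sub_le (h : E.IsSmooth P.L P.M) (k : ℕ) (s : S) :
    |E.valueIter P.γ k s - E.valueIter P.γ (k + 1) s| ≤ P.cap * P.γ ^ k := by
  induction k generalizing s with
  | zero => simpa [valueIter] using abs_valueIter_le h 1 s
  | succ k ih =>
    have := abs_bellman_sub_le h (E.measurable_valueIter P.γ k)
      (E.measurable_valueIter P.γ (k + 1)) (abs_valueIter_le h k) (abs_valueIter_le h (k + 1))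
      (mul_nonneg P.cap_pos.le (pow_nonneg P.γ_nonneg k)) ih s
    calc _ ≤ _ := this
      _ = _ := by ring

/-- Value iteration converges geometrically at each state. A pointwise limit of measurable functions
is measurable, so no function space is needed. -/
lemma exists_isValue (h : E.IsSmooth P.L P.M) : ∃ V, E.IsValue P.γ V := by
  have hu : ∀ s k, dist (E.valueIter P.γ k s) (E.valueIter P.γ (k + 1) s) ≤ P.cap * P.γ ^ k :=
    fun s k => abs_valueIter_sub_le h k s
  have hl : ∀ s, ∃ v, Tendsto (fun k => E.valueIter P.γ k s) atTop (𝓝 v) := fun s =>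
    cauchySeq_tendsto_of_complete (cauchySeq_of_le_geometric _ _ P.γ_lt_one (hu s))
  choose V hV using hl
  have hVm : Measurable V :=
    measurable_of_tendsto_metrizable (E.measurable_valueIter P.γ) (tendsto_pi_nhds.2 hV)
  have hVb : ∀ s, |V s| ≤ P.cap := fun s =>
    le_of_tendsto (hV s).abs (Eventually.of_forall fun k => abs_valueIter_le h k s)
  refine ⟨V, hVm, ⟨_, hVb⟩, fun s => ?_⟩
  have hd : ∀ k s, |E.valueIter P.γ k s - V s| ≤ P.cap * P.γ ^ k / (1 - P.γ) := fun k s =>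
    dist_le_of_le_geometric_of_tendsto _ _ P.γ_lt_one (hu s) (hV s) k
  have h1 : Tendsto (fun k => E.valueIter P.γ (k + 1) s) atTop
      (𝓝 (E.F s (E.qValue P.γ V s))) := by
    rw [tendsto_iff_dist_tendsto_zero]
    have h0 : Tendsto (fun k => P.γ * (P.cap * P.γ ^ k / (1 - P.γ))) atTop (𝓝 0) := by
      have := ((tendsto_pow_atTop_nhds_zero_of_lt_one P.γ_nonneg P.γ_lt_one).const_mul
        P.cap).div_const (1 - P.γ)
      simpa using this.const_mul P.γ
    refine squeeze_zero (fun _ => dist_nonneg) (fun k => ?_) h0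
    have := pow_nonneg P.γ_nonneg k
    have := P.cap_pos
    have := P.one_sub_pos
    exact abs_bellman_sub_le h (E.measurable_valueIter P.γ k) hVm (abs_valueIter_le h k) hVb
      (by positivity) (hd k) s
  exact tendsto_nhds_unique ((tendsto_add_atTop_iff_nat 1).2 (hV s)) h1

lemma IsValue.unique (h : E.IsSmooth P.L P.M) {V W : S → ℝ} (hV : E.IsValue P.γ V)
    (hW : E.IsValue P.γ W) : V = W := by
  obtain ⟨A, hA⟩ := hV.bounded
  obtain ⟨B, hB⟩ := hW.bounded
  ext s
  have hA0 : 0 ≤ A := (abs_nonneg _).trans (hA s)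
  have hB0 : 0 ≤ B := (abs_nonneg _).trans (hB s)
  have key : ∀ k s, |V s - W s| ≤ (A + B) * P.γ ^ k := by
    intro k
    induction k with
    | zero =>
      intro s
      simpa using (abs_sub _ _).trans (add_le_add (hA s) (hB s))
    | succ k ih =>
      intro s
      rw [hV.bellman s, hW.bellman s]
      have := pow_nonneg P.γ_nonneg k
      have := abs_bellman_sub_le h hV.measurable hW.measurable hA hB (by positivity) ih s
      calc _ ≤ _ := this
        _ = _ := by ring
  have h0 : Tendsto (fun k => (A + B) * P.γ ^ k) atTop (𝓝 0) := by
    simpa using (tendsto_pow_atTop_nhds_zero_of_lt_one P.γ_nonneg P.γ_lt_one).const_mul (A + B)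
  have := ge_of_tendsto' h0 fun k => key k s
  exact sub_eq_zero.1 (abs_nonpos_iff.1 this)

namespace IsValue

variable {V : S → ℝ}

/-- The given bound `B` is arbitrary, but each use of the Bellman equation shrinks the excess over
`cap` by `γ`. -/
lemma abs_le_cap (h : E.IsSmooth P.L P.M) (hV : E.IsValue P.γ V) (s : S) : |V s| ≤ P.cap := by
  obtain ⟨B, hB⟩ := hV.bounded
  have hB0 : 0 ≤ B := (abs_nonneg _).trans (hB s)
  have key : ∀ k s, |V s| ≤ P.cap + P.γ ^ k * B := by
    intro k
    induction k with
    | zero =>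
      intro s
      have := hB s
      have := P.cap_pos
      linarith
    | succ k ih =>
      intro s
      have := pow_nonneg P.γ_nonneg k
      have := P.cap_pos
      have h1 := abs_bellman_le h (by positivity) ih s
      rw [← hV.bellman s] at h1
      have h2 := P.cap_eq
      calc _ ≤ _ := h1
        _ = (1 + P.M + P.γ * P.cap) + P.γ ^ (k + 1) * B := by ring
        _ = _ := by rw [← h2]
  have h0 : Tendsto (fun k => P.cap + P.γ ^ k * B) atTop (𝓝 P.cap) := by
    simpa using ((tendsto_pow_atTop_nhds_zero_of_lt_one P.γ_nonneg
      P.γ_lt_one).mul_const B).const_add P.cap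
  exact ge_of_tendsto' h0 fun k => key k s

lemma abs_qValue_le_cap (h : E.IsSmooth P.L P.M) (hV : E.IsValue P.γ V) (s : S) (a : Fin P.K) :
    |E.qValue P.γ V s a| ≤ P.cap := by
  have h1 := E.abs_qValue_le P.γ_nonneg (hV.abs_le_cap h) s a
  have h2 := P.cap_eq
  have h3 := P.M_nonneg
  linarith

/-- Rewards are nonnegative, so a lower bound `-b` on `V` improves to `-γ b` with each use of the
Bellman equation. -/
lemma qValue_nonneg (h : E.IsSmooth P.L P.M) (hV : E.IsValue P.γ V) (h0 : ∀ s, 0 ≤ E.F s 0)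
    (s : S) (a : Fin P.K) : 0 ≤ E.qValue P.γ V s a := by
  have key : ∀ k s, -(P.γ ^ k * P.cap) ≤ V s := by
    intro k
    induction k with
    | zero =>
      intro s
      simpa using (abs_le.1 (hV.abs_le_cap h s)).1
    | succ k ih =>
      intro s
      have h1 := E.qValue_ge P.γ_nonneg hV.measurable (hV.abs_le_cap h) ih s
      have := pow_nonneg P.γ_nonneg k
      have := P.cap_pos
      have := P.γ_nonneg
      have h2 := h.sub_le_of_neg_le s (by positivity) h1
      rw [← hV.bellman s] at h2
      have h3 := h0 s
      rw [pow_succ']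
      linarith
  have hV0 : ∀ s, 0 ≤ V s := fun s => by
    have h0 : Tendsto (fun k => -(P.γ ^ k * P.cap)) atTop (𝓝 0) := by
      simpa using ((tendsto_pow_atTop_nhds_zero_of_lt_one P.γ_nonneg
        P.γ_lt_one).mul_const P.cap).neg
    exact le_of_tendsto' h0 fun k => key k s
  have := E.qValue_ge P.γ_nonneg hV.measurable (hV.abs_le_cap h) (b := 0) (by simpa using hV0) s a
  simpa using this

end IsValue

namespace ClipLevel

variable {V : S → ℝ} {lo : ℝ}

lemma le_qValue (hc : E.ClipLevel P V lo) (h : E.IsSmooth P.L P.M) (hV : E.IsValue P.γ V) (s : S)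
    (a : Fin P.K) : lo ≤ E.qValue P.γ V s a := by
  rcases hc with ⟨rfl, h0 | h0⟩ | rfl
  · exact hV.qValue_nonneg h h0 s a
  · exact h0 s a
  · exact (abs_le.1 (hV.abs_qValue_le_cap h s a)).1

lemma neg_cap_le (hc : E.ClipLevel P V lo) : -P.cap ≤ lo := by
  have := P.cap_pos
  rcases hc with ⟨rfl, -⟩ | rfl
  · linarith
  · exact le_rfl

end ClipLevel

end Env

/-! ## Measures that agree up to a small mass -/

/-- `μ` exceeds `ν` by at most `η` on every measurable function with values in `[0, 1]`. -/
def Near {α : Type*} [MeasurableSpace α] (η : ENNReal) (μ ν : Measure α) : Prop :=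
  ∀ f : α → ENNReal, Measurable f → (∀ x, f x ≤ 1) → ∫⁻ x, f x ∂μ ≤ ∫⁻ x, f x ∂ν + η

namespace Near

variable {α β : Type*} [MeasurableSpace α] [MeasurableSpace β] {η ζ : ENNReal}
  {μ ν ρ : Measure α}

lemma refl (μ : Measure α) (η : ENNReal) : Near η μ μ := fun _ _ _ => le_self_add

lemma mono (h : Near η μ ν) (hle : η ≤ ζ) : Near ζ μ ν := fun f hf h1 =>
  (h f hf h1).trans (add_le_add le_rfl hle)

lemma trans (h : Near η μ ν) (h' : Near ζ ν ρ) : Near (η + ζ) μ ρ := fun f hf h1 =>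
  calc _ ≤ _ := h f hf h1
    _ ≤ (∫⁻ x, f x ∂ρ + ζ) + η := add_le_add (h' f hf h1) le_rfl
    _ = _ := by rw [add_assoc, add_comm ζ]

lemma map (h : Near η μ ν) {g : α → β} (hg : Measurable g) : Near η (μ.map g) (ν.map g) := by
  intro f hf h1
  rw [lintegral_map hf hg, lintegral_map hf hg]
  exact h _ (hf.comp hg) fun x => h1 _

lemma measure_le (h : Near η μ ν) {A : Set α} (hA : MeasurableSet A) : μ A ≤ ν A + η := by
  have := h (A.indicator 1) (measurable_one.indicator hA)
    (fun x => Set.indicator_le_self' (fun _ _ => zero_le) x)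
  simpa [lintegral_indicator_one hA] using this

/-- Changing a measure on a set of measure at most `η`. -/
lemma of_map_eq {g : α → β} {h : α → β} (hg : Measurable g) (hh : Measurable h) {A : Set α}
    (hA : MeasurableSet A) (hgh : ∀ x ∉ A, g x = h x) (hμ : μ A ≤ η) :
    Near η (μ.map g) (μ.map h) := by
  intro f hf h1
  rw [lintegral_map hf hg, lintegral_map hf hh]
  calc ∫⁻ x, f (g x) ∂μ ≤ ∫⁻ x, (f (h x) + A.indicator 1 x) ∂μ := by
        refine lintegral_mono fun x => ?_
        by_cases hx : x ∈ A
        · simpa [hx] using (h1 _).trans le_add_self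
        · simp [hx, hgh x hx]
    _ = ∫⁻ x, f (h x) ∂μ + μ A := by
        rw [lintegral_add_left (f := fun x => f (h x)) (hf.comp hh), lintegral_indicator_one hA]
    _ ≤ _ := add_le_add le_rfl hμ

/-- The second stage is exchanged first, pointwise under `κ a`. The inner integral against `ξ'` then
is a test function with values in `[0, 1]` for the first stage. -/
lemma compProd {κ κ' : Kernel α β} {γ : Type*} [MeasurableSpace γ] {ξ ξ' : Kernel (α × β) γ}
    [IsMarkovKernel κ] [IsMarkovKernel κ'] [IsMarkovKernel ξ] [IsMarkovKernel ξ'] {a : α}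
    (h : Near η (κ a) (κ' a)) (h' : ∀ b, Near ζ (ξ (a, b)) (ξ' (a, b))) :
    Near (η + ζ) ((κ ⊗ₖ ξ) a) ((κ' ⊗ₖ ξ') a) := by
  intro f hf h1
  rw [Kernel.lintegral_compProd _ _ _ hf, Kernel.lintegral_compProd _ _ _ hf]
  have hm : Measurable fun b => ∫⁻ c, f (b, c) ∂ξ' (a, b) :=
    Measurable.lintegral_kernel_prod_right' (κ := ξ'.comap (Prod.mk a) (by fun_prop)) hf
  calc ∫⁻ b, ∫⁻ c, f (b, c) ∂ξ (a, b) ∂κ a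
      ≤ ∫⁻ b, (∫⁻ c, f (b, c) ∂ξ' (a, b) + ζ) ∂κ a :=
        lintegral_mono fun b => h' b _ (by fun_prop) fun _ => h1 _
    _ = ∫⁻ b, ∫⁻ c, f (b, c) ∂ξ' (a, b) ∂κ a + ζ := by
        rw [lintegral_add_right _ measurable_const]; simp
    _ ≤ (∫⁻ b, ∫⁻ c, f (b, c) ∂ξ' (a, b) ∂κ' a + η) + ζ := by
        refine add_le_add (h _ hm fun b => ?_) le_rfl
        calc ∫⁻ c, f (b, c) ∂ξ' (a, b) ≤ ∫⁻ _, 1 ∂ξ' (a, b) := lintegral_mono fun _ => h1 _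
          _ = 1 := by simp
    _ = _ := by rw [add_assoc]

/-- A hybrid argument: the factors are exchanged one at a time, each at cost `η`. -/
lemma pi {ι : Type*} [Fintype ι] {μ ν : ι → Measure α} [∀ i, IsProbabilityMeasure (μ i)]
    [∀ i, IsProbabilityMeasure (ν i)] (h : ∀ i, Near η (μ i) (ν i)) :
    Near (Fintype.card ι * η) (Measure.pi μ) (Measure.pi ν) := by
  classical
  intro f hf h1
  have key : ∀ (s : Finset ι) (x : ι → α),
      (∫⋯∫⁻_s, f ∂μ) x ≤ (∫⋯∫⁻_s, f ∂ν) x + s.card * η := by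
    intro s
    induction s using Finset.induction_on with
    | empty => simp
    | insert i s hi ih =>
      intro x
      have hle : ∀ y, (∫⋯∫⁻_s, f ∂ν) y ≤ 1 := fun y => by
        calc (∫⋯∫⁻_s, f ∂ν) y ≤ (∫⋯∫⁻_s, (fun _ => 1) ∂ν) y := lmarginal_mono (fun z => h1 z) y
          _ = 1 := by simp [lmarginal]
      rw [lmarginal_insert f hf hi, lmarginal_insert f hf hi]
      have hm : Measurable fun z => (∫⋯∫⁻_s, f ∂ν) (Function.update x i z) :=
        (hf.lmarginal ν).comp (measurable_update x)
      calc ∫⁻ z, (∫⋯∫⁻_s, f ∂μ) (Function.update x i z) ∂μ i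
          ≤ ∫⁻ z, ((∫⋯∫⁻_s, f ∂ν) (Function.update x i z) + s.card * η) ∂μ i :=
            lintegral_mono fun z => ih _
        _ = ∫⁻ z, (∫⋯∫⁻_s, f ∂ν) (Function.update x i z) ∂μ i + s.card * η := by
            rw [lintegral_add_right _ measurable_const]; simp
        _ ≤ (∫⁻ z, (∫⋯∫⁻_s, f ∂ν) (Function.update x i z) ∂ν i + η) + s.card * η :=
            add_le_add (h i _ hm fun _ => hle _) le_rfl
        _ = _ := by
            rw [Finset.card_insert_of_notMem hi]
            push_cast
            ring
  -- Marginals are evaluated at a base point, here a constant function, which needs an element of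
  -- `α`.
  rcases isEmpty_or_nonempty α with hα | ⟨⟨a⟩⟩
  · rcases isEmpty_or_nonempty ι with hι | ⟨⟨i⟩⟩
    · rw [Measure.pi_of_empty μ, Measure.pi_of_empty ν]
      exact le_self_add
    · exact absurd (measure_univ (μ := μ i)) (by simp [Set.univ_eq_empty_iff.2 hα])
  · have := key Finset.univ fun _ => a
    rwa [← lintegral_eq_lmarginal_univ, ← lintegral_eq_lmarginal_univ] at this

end Near

/-! ## The building blocks of the algorithm -/

section Kernels

lemma id_prod_eq_map {α β : Type*} [MeasurableSpace α] [MeasurableSpace β] (G : Kernel α β)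
    [IsSFiniteKernel G] (a : α) : (Kernel.id ×ₖ G) a = (G a).map (Prod.mk a) := by
  ext s hs
  rw [Kernel.id_prod_apply' _ _ hs, Measure.map_apply measurable_prodMk_left hs]

variable {S X ι : Type*} [MeasurableSpace S] [MeasurableSpace X] [Fintype ι]

lemma indepKernel_apply (κ : ι → Kernel S X) [h : ∀ i, IsMarkovKernel (κ i)] (s : S) :
    indepKernel κ s = Measure.pi fun i => κ i s := by
  rw [indepKernel, dif_pos h]
  rfl

instance (κ : ι → Kernel S X) [∀ i, IsMarkovKernel (κ i)] : IsMarkovKernel (indepKernel κ) :=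
  ⟨fun s => by rw [indepKernel_apply]; infer_instance⟩

end Kernels

namespace Env

variable {S : Type u} [MeasurableSpace S] {K : ℕ} (E : Env S K)

lemma IsSmooth.isMarkovKernel_draw {E : Env S K} {L M : ℝ} (h : E.IsSmooth L M) :
    IsMarkovKernel E.draw := by
  refine ⟨fun p => ?_⟩
  refine isProbabilityMeasure_sum_dirac
    (fun a => div_nonneg (h.grad_nonneg _ _ a) (h.gradNorm_pos _ _).le) ?_
  rw [← Finset.sum_div, ← h.gradNorm_eq]
  exact div_self (h.gradNorm_pos _ _).ne'

section SampleQ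

variable (γ : ℝ) (T : Kernel S (ℝ × ℕ)) [IsMarkovKernel T]

lemma measurable_sampleQ_out :
    Measurable fun p : (ℝ × S) × (ℝ × ℕ) => (p.1.1 + γ * p.2.1, p.2.2 + 1) := by fun_prop

instance : IsMarkovKernel (E.sampleQ γ T) :=
  Kernel.IsMarkovKernel.map _ (measurable_sampleQ_out γ)

lemma ae_sampleQ_iff {p : ℝ × ℕ → Prop} (hp : MeasurableSet {x | p x}) (q : S × Fin K) :
    (∀ᵐ x ∂E.sampleQ γ T q, p x) ↔
      ∀ᵐ o ∂E.oracle q, ∀ᵐ v ∂T o.2, p (o.1 + γ * v.1, v.2 + 1) := by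
  rw [sampleQ, Kernel.map_apply _ (measurable_sampleQ_out γ),
    ae_map_iff (measurable_sampleQ_out γ).aemeasurable hp]
  exact Kernel.ae_compProd_iff (measurable_sampleQ_out γ hp)

variable {T} in
lemma near_sampleQ {T' : Kernel S (ℝ × ℕ)} [IsMarkovKernel T'] {η : ENNReal}
    (h : ∀ s, Near η (T s) (T' s)) (q : S × Fin K) :
    Near η (E.sampleQ γ T q) (E.sampleQ γ T' q) := by
  rw [sampleQ, sampleQ, Kernel.map_apply _ (measurable_sampleQ_out γ),
    Kernel.map_apply _ (measurable_sampleQ_out γ)]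
  refine Near.map ?_ (measurable_sampleQ_out γ)
  have := Near.compProd (κ := E.oracle) (κ' := E.oracle)
    (ξ := T.comap (fun p : (S × Fin K) × (ℝ × S) => p.2.2) (by fun_prop))
    (ξ' := T'.comap (fun p : (S × Fin K) × (ℝ × S) => p.2.2) (by fun_prop))
    (Near.refl (E.oracle q) 0) (fun b => by simpa [Kernel.comap_apply] using h b.2)
  simpa using this

lemma integral_sampleQ {q : S × Fin K} {f : ℝ × ℕ → ℝ} (hf : Measurable f)
    (hi : Integrable f (E.sampleQ γ T q)) :
    ∫ x, f x ∂E.sampleQ γ T q =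
      ∫ o, ∫ v, f (o.1 + γ * v.1, v.2 + 1) ∂T o.2 ∂E.oracle q := by
  rw [sampleQ, Kernel.map_apply _ (measurable_sampleQ_out γ)] at hi ⊢
  rw [integral_map (measurable_sampleQ_out γ).aemeasurable hf.aestronglyMeasurable]
  exact ProbabilityTheory.integral_compProd (hi.comp_measurable (measurable_sampleQ_out γ))

end SampleQ

section Steps

/-- Apply the Bellman operator to an estimate of the `Q`-values. -/
noncomputable def evalStep (G : Kernel S ((Fin K → ℝ) × ℕ)) : Kernel S (ℝ × ℕ) :=
  (Kernel.id ×ₖ G).map fun p => (E.F p.1 p.2.1, p.2.2)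

/-- Linearize the Bellman operator at an estimate of the `Q`-values drawn from `G`, and estimate
the linear part by a single sample from `H`. -/
noncomputable def linStep (G : Kernel S ((Fin K → ℝ) × ℕ)) (H : Kernel (S × Fin K) (ℝ × ℕ)) :
    Kernel S (ℝ × ℕ) :=
  (((Kernel.id ×ₖ G) ⊗ₖ
      E.draw.comap (fun p : S × (S × ((Fin K → ℝ) × ℕ)) => (p.2.1, p.2.2.1)) (by fun_prop)) ⊗ₖ
    H.comap (fun p : S × ((S × ((Fin K → ℝ) × ℕ)) × Fin K) => (p.1, p.2.2)) (by fun_prop)).map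
    fun p =>
      let s := p.1.1.1
      let Q := p.1.1.2.1
      (E.F s Q - ∑ a, Q a * E.grad s Q a + p.2.1 * E.gradNorm s Q, p.1.1.2.2 + p.2.2)

lemma measurable_evalStep_out :
    Measurable fun p : S × ((Fin K → ℝ) × ℕ) => (E.F p.1 p.2.1, p.2.2) :=
  (E.measurable_F.comp (by fun_prop : Measurable fun p : S × ((Fin K → ℝ) × ℕ) =>
    (p.1, p.2.1))).prodMk (by fun_prop)

lemma measurable_linStep_out :
    Measurable fun p : ((S × ((Fin K → ℝ) × ℕ)) × Fin K) × (ℝ × ℕ) =>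
      (E.F p.1.1.1 p.1.1.2.1 - ∑ a, p.1.1.2.1 a * E.grad p.1.1.1 p.1.1.2.1 a
        + p.2.1 * E.gradNorm p.1.1.1 p.1.1.2.1, p.1.1.2.2 + p.2.2) := by
  have h0 : Measurable fun p : ((S × ((Fin K → ℝ) × ℕ)) × Fin K) × (ℝ × ℕ) =>
    (p.1.1.1, p.1.1.2.1) := by fun_prop
  have h1 := E.measurable_F.comp h0
  have h2 := fun a => (E.measurable_grad a).comp h0
  have h3 := E.measurable_gradNorm.comp h0
  have h4 : Measurable fun p : ((S × ((Fin K → ℝ) × ℕ)) × Fin K) × (ℝ × ℕ) =>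
      ∑ a, p.1.1.2.1 a * E.grad p.1.1.1 p.1.1.2.1 a :=
    Finset.measurable_sum _ fun a _ =>
      (by fun_prop : Measurable fun p : ((S × ((Fin K → ℝ) × ℕ)) × Fin K) × (ℝ × ℕ) =>
        p.1.1.2.1 a).mul (h2 a)
  exact ((h1.sub h4).add ((by fun_prop : Measurable fun p :
    ((S × ((Fin K → ℝ) × ℕ)) × Fin K) × (ℝ × ℕ) => p.2.1).mul h3)).prodMk (by fun_prop)

lemma measurable_linStep_out_prodMk (s : S) :
    Measurable fun p : (((Fin K → ℝ) × ℕ) × Fin K) × (ℝ × ℕ) =>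
      (E.F s p.1.1.1 - ∑ a, p.1.1.1 a * E.grad s p.1.1.1 a
        + p.2.1 * E.gradNorm s p.1.1.1, p.1.1.2 + p.2.2) :=
  E.measurable_linStep_out.comp (by fun_prop : Measurable
    fun p : (((Fin K → ℝ) × ℕ) × Fin K) × (ℝ × ℕ) => (((s, p.1.1), p.1.2), p.2))

variable (G G' : Kernel S ((Fin K → ℝ) × ℕ)) [IsMarkovKernel G] [IsMarkovKernel G']

instance : IsMarkovKernel (E.evalStep G) :=
  Kernel.IsMarkovKernel.map _ E.measurable_evalStep_out

lemma evalStep_apply (s : S) : E.evalStep G s = (G s).map fun q => (E.F s q.1, q.2) := by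
  rw [evalStep, Kernel.map_apply _ E.measurable_evalStep_out, id_prod_eq_map,
    Measure.map_map E.measurable_evalStep_out measurable_prodMk_left]
  rfl

lemma measurable_F_prodMk (s : S) :
    Measurable fun q : (Fin K → ℝ) × ℕ => (E.F s q.1, q.2) :=
  E.measurable_evalStep_out.comp measurable_prodMk_left

lemma ae_evalStep_iff {p : ℝ × ℕ → Prop} (hp : MeasurableSet {x | p x}) (s : S) :
    (∀ᵐ x ∂E.evalStep G s, p x) ↔ ∀ᵐ q ∂G s, p (E.F s q.1, q.2) := by
  rw [evalStep_apply, ae_map_iff (E.measurable_F_prodMk s).aemeasurable hp]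

variable {G G'} in
lemma near_evalStep {η : ENNReal} {s : S} (h : Near η (G s) (G' s)) :
    Near η (E.evalStep G s) (E.evalStep G' s) := by
  rw [evalStep_apply, evalStep_apply]
  exact h.map (E.measurable_F_prodMk s)

section Linear

variable (H H' : Kernel (S × Fin K) (ℝ × ℕ)) [IsMarkovKernel H] [IsMarkovKernel H']
  [IsMarkovKernel E.draw]

instance : IsMarkovKernel (E.linStep G H) :=
  Kernel.IsMarkovKernel.map _ E.measurable_linStep_out

/-- The copy of the state carried by `Kernel.id` is frozen at `s`. The three facts on `linStep`
below are proved in this form. -/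
lemma linStep_apply (s : S) : E.linStep G H s =
    (((G ⊗ₖ E.draw.comap (fun p : S × ((Fin K → ℝ) × ℕ) => (p.1, p.2.1)) (by fun_prop)) ⊗ₖ
      H.comap (fun p : S × (((Fin K → ℝ) × ℕ) × Fin K) => (p.1, p.2.2)) (by fun_prop)) s).map
      fun p => (E.F s p.1.1.1 - ∑ a, p.1.1.1 a * E.grad s p.1.1.1 a
        + p.2.1 * E.gradNorm s p.1.1.1, p.1.1.2 + p.2.2) := by
  have hm := E.measurable_linStep_out
  have hm' := E.measurable_linStep_out_prodMk s
  refine Measure.ext_of_lintegral _ fun f hf => ?_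
  have hf1 := hf.comp hm
  have hf2 : Measurable fun b : (S × ((Fin K → ℝ) × ℕ)) × Fin K => ∫⁻ c, f
      (E.F b.1.1 b.1.2.1 - ∑ a, b.1.2.1 a * E.grad b.1.1 b.1.2.1 a
        + c.1 * E.gradNorm b.1.1 b.1.2.1, b.1.2.2 + c.2) ∂H (s, b.2) :=
    Measurable.lintegral_kernel_prod_right' (κ := H.comap
      (fun b : (S × ((Fin K → ℝ) × ℕ)) × Fin K => (s, b.2)) (by fun_prop)) hf1
  have hf3 : Measurable fun b : S × ((Fin K → ℝ) × ℕ) => ∫⁻ a, ∫⁻ c, f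
      (E.F b.1 b.2.1 - ∑ a, b.2.1 a * E.grad b.1 b.2.1 a
        + c.1 * E.gradNorm b.1 b.2.1, b.2.2 + c.2) ∂H (s, a) ∂E.draw (b.1, b.2.1) :=
    Measurable.lintegral_kernel_prod_right' (κ := E.draw.comap
      (fun b : S × ((Fin K → ℝ) × ℕ) => (b.1, b.2.1)) (by fun_prop)) hf2
  rw [linStep, Kernel.map_apply _ hm, lintegral_map hf hm, lintegral_map hf hm']
  refine (Kernel.lintegral_compProd _ _ _ hf1).trans (Eq.trans ?_
    (Kernel.lintegral_compProd _ _ _ (hf.comp hm')).symm)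
  refine (Kernel.lintegral_compProd _ _ _ hf2).trans ?_
  refine (Kernel.lintegral_id_prod hf3 _ _).trans ?_
  have hf4 := hf2.comp (by fun_prop : Measurable fun b : ((Fin K → ℝ) × ℕ) × Fin K => ((s, b.1), b.2))
  exact (Kernel.lintegral_compProd G (E.draw.comap (fun p : S × ((Fin K → ℝ) × ℕ) =>
    (p.1, p.2.1)) (by fun_prop)) s hf4).symm

variable {G G' H H'} in
lemma near_linStep {η ζ : ENNReal} {s : S} (hG : Near η (G s) (G' s))
    (hH : ∀ p, Near ζ (H p) (H' p)) :
    Near (η + ζ) (E.linStep G H s) (E.linStep G' H' s) := by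
  rw [linStep_apply, linStep_apply]
  refine Near.map (Near.compProd ?_ fun b => ?_) (E.measurable_linStep_out_prodMk s)
  · rw [← add_zero η]
    exact Near.compProd hG fun b => Near.refl _ 0
  · simpa [Kernel.comap_apply] using hH _

lemma ae_linStep {p : ℝ × ℕ → Prop} (hp : MeasurableSet {x | p x}) {s : S}
    (h : ∀ᵐ q ∂G s, ∀ a, ∀ᵐ v ∂H (s, a),
        p (E.F s q.1 - ∑ a, q.1 a * E.grad s q.1 a + v.1 * E.gradNorm s q.1, q.2 + v.2)) :
    ∀ᵐ x ∂E.linStep G H s, p x := by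
  have hm := E.measurable_linStep_out_prodMk s
  have hq := hm hp
  rw [linStep_apply, ae_map_iff hm.aemeasurable hp]
  refine Kernel.ae_compProd_of_ae_ae hq (Kernel.ae_compProd_of_ae_ae ?_ ?_)
  -- The inner almost-sure statement says that a measurably varying mass is zero, hence defines a
  -- measurable set.
  · have := Kernel.measurable_kernel_prodMk_left' (η := H.comap
      (fun p : S × (((Fin K → ℝ) × ℕ) × Fin K) => (p.1, p.2.2)) (by fun_prop)) hq.compl s
    exact this (measurableSet_singleton 0)
  · filter_upwards [h] with q hq
    exact Eventually.of_forall hq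

lemma integral_linStep {f : ℝ × ℕ → ℝ} (hf : Measurable f) {s : S}
    (hi : Integrable f (E.linStep G H s)) :
    ∫ x, f x ∂E.linStep G H s =
      ∫ q, ∫ a, ∫ v, f (E.F s q.1 - ∑ a, q.1 a * E.grad s q.1 a + v.1 * E.gradNorm s q.1,
        q.2 + v.2) ∂H (s, a) ∂E.draw (s, q.1) ∂G s := by
  have hm := E.measurable_linStep_out_prodMk s
  rw [linStep_apply] at hi ⊢
  have hi' := hi.comp_measurable hm
  rw [integral_map hm.aemeasurable hf.aestronglyMeasurable]
  exact (ProbabilityTheory.integral_compProd hi').trans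
    (ProbabilityTheory.integral_compProd hi'.integral_compProd)

end Linear

end Steps

end Env

/-! ## The recursion and the number of oracle calls -/

namespace Params

variable (P : Params)

lemma kappa_pos : 0 < P.kappa := by
  have := P.sqrt_lt_one
  have := P.L_pos
  have : (0 : ℝ) < P.K := Nat.cast_pos.2 P.K_pos
  exact div_pos (by linarith) (by positivity)

lemma relax_pos {ε : ℝ} (hε : 0 < ε) : 0 < P.relax ε := by
  unfold relax
  split_ifs with h
  · exact P.cap_pos
  · have := lt_of_le_of_ne P.γ_nonneg (Ne.symm h)
    positivity

/-- Induction along the recursive calls of `sampleV`. -/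
lemma accuracy_induction {p : ℝ → Prop} (h1 : ∀ ε, P.cap ≤ ε → p ε)
    (h2 : ∀ ε, 0 < ε → ε < P.cap → P.kappa ≤ ε → p (P.relax ε) → p ε)
    (h3 : ∀ ε, 0 < ε → ε < P.cap → ε < P.kappa → p (P.relax √(P.kappa * ε)) → p (P.relax ε) →
      p ε) {ε : ℝ} (hε : 0 < ε) : p ε := by
  induction hd : P.depth ε using Nat.strong_induction_on generalizing ε with
  | _ d ih =>
    subst hd
    rcases le_or_gt P.cap ε with hc | hc
    · exact h1 ε hc
    rcases le_or_gt P.kappa ε with hk | hk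
    · exact h2 ε hε hc hk (ih _ (P.depth_lt hε hc le_rfl) (P.relax_pos hε) rfl)
    · have := P.kappa_pos
      exact h3 ε hε hc hk
        (ih _ (P.depth_lt hε hc (P.le_sqrt_kappa hε hk)) (P.relax_pos (by positivity)) rfl)
        (ih _ (P.depth_lt hε hc le_rfl) (P.relax_pos hε) rfl)

/-- The number of oracle calls of `estimateQ(·, ε)` if the procedure that it calls makes `c`. -/
noncomputable def callsQ (δ' : ℝ) (c : ℕ) (ε : ℝ) : ℕ := P.K * P.N δ' ε * (c + 1)

/-- The number of oracle calls of `sampleV(·, ε)`. -/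
noncomputable def callsV (δ' ε : ℝ) : ℕ :=
  if _h : ε ≤ 0 ∨ P.cap ≤ ε then 0
  else if _hκ : P.kappa ≤ ε then P.callsQ δ' (callsV δ' (P.relax ε)) ε
  else P.callsQ δ' (callsV δ' (P.relax √(P.kappa * ε))) √(P.kappa * ε)
    + (callsV δ' (P.relax ε) + 1)
termination_by P.depth ε
decreasing_by
  · push Not at _h
    exact P.depth_lt _h.1 _h.2 le_rfl
  · push Not at _h _hκ
    exact P.depth_lt _h.1 _h.2 (P.le_sqrt_kappa _h.1 _hκ)
  · push Not at _h
    exact P.depth_lt _h.1 _h.2 le_rfl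

/-- The number of oracle calls of `SmoothCruiser(·, ε, δ')`. -/
noncomputable def calls (ε δ' : ℝ) : ℕ := P.callsQ δ' (P.callsV δ' (P.relax ε)) ε

variable {P} (δ' : ℝ) {ε : ℝ}

lemma callsV_of_cap_le (h : P.cap ≤ ε) : P.callsV δ' ε = 0 := by
  rw [callsV, dif_pos (Or.inr h)]

lemma callsV_of_kappa_le (hε : 0 < ε) (hc : ε < P.cap) (hk : P.kappa ≤ ε) :
    P.callsV δ' ε = P.callsQ δ' (P.callsV δ' (P.relax ε)) ε := by
  rw [callsV, dif_neg (by push Not; exact ⟨hε, hc⟩), dif_pos hk]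

lemma callsV_of_lt_kappa (hε : 0 < ε) (hc : ε < P.cap) (hk : ε < P.kappa) :
    P.callsV δ' ε = P.callsQ δ' (P.callsV δ' (P.relax √(P.kappa * ε))) √(P.kappa * ε)
      + (P.callsV δ' (P.relax ε) + 1) := by
  rw [callsV, dif_neg (by push Not; exact ⟨hε, hc⟩), dif_neg hk.not_ge]

end Params

namespace Env

variable {S : Type u} [MeasurableSpace S] {P : Params} (E : Env S P.K) (lo δ' : ℝ)

lemma measurableSet_snd_eq {β : Type*} [MeasurableSpace β] (n : ℕ) :
    MeasurableSet {x : β × ℕ | x.2 = n} :=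
  measurable_snd (measurableSet_singleton n)

lemma ae_sampleQ_calls {T : Kernel S (ℝ × ℕ)} [IsMarkovKernel T] {c : ℕ}
    (h : ∀ s, ∀ᵐ x ∂T s, x.2 = c) (p : S × Fin P.K) :
    ∀ᵐ x ∂E.sampleQ P.γ T p, x.2 = c + 1 := by
  refine (ae_sampleQ_iff E P.γ T (p := fun x => x.2 = c + 1) (measurableSet_snd_eq _) _).2 ?_
  refine Eventually.of_forall fun o => ?_
  filter_upwards [h o.2] with v hv
  rw [hv]

section EstimateQ

/-- The estimates that `estimateQ` computes from its samples, with the total of their counters. -/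
noncomputable def clippedMeans (P : Params) (lo : ℝ) (n : ℕ)
    (w : Fin P.K × Fin n → ℝ × ℕ) : (Fin P.K → ℝ) × ℕ :=
  (fun a => min P.cap (max lo ((∑ k, (w (a, k)).1) / n)), ∑ i, (w i).2)

lemma measurable_clippedMeans (n : ℕ) : Measurable (clippedMeans P lo n) := by
  unfold clippedMeans
  fun_prop

variable (T : Kernel S (ℝ × ℕ)) [IsMarkovKernel T] (ε : ℝ)

instance : IsMarkovKernel (estimateQ P E lo δ' T ε) :=
  Kernel.IsMarkovKernel.map _ (measurable_clippedMeans lo _)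

lemma estimateQ_apply (s : S) : estimateQ P E lo δ' T ε s =
    (Measure.pi fun i : Fin P.K × Fin (P.N δ' ε) => E.sampleQ P.γ T (s, i.1)).map
      (clippedMeans P lo _) := by
  have h := Kernel.map_apply (indepKernel fun i : Fin P.K × Fin (P.N δ' ε) =>
    (E.sampleQ P.γ T).comap (fun s => (s, i.1)) (by fun_prop)) (measurable_clippedMeans lo _) s
  rw [indepKernel_apply] at h
  exact h

variable {T} in
lemma near_estimateQ {T' : Kernel S (ℝ × ℕ)} [IsMarkovKernel T'] {η : ENNReal}
    (h : ∀ s, Near η (T s) (T' s)) (s : S) :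
    Near ((P.K * P.N δ' ε : ℕ) * η) (estimateQ P E lo δ' T ε s) (estimateQ P E lo δ' T' ε s) := by
  rw [estimateQ_apply, estimateQ_apply]
  have := (Near.pi fun i : Fin P.K × Fin (P.N δ' ε) => E.near_sampleQ P.γ h (s, i.1)).map
    (measurable_clippedMeans (P := P) lo (P.N δ' ε))
  simpa using this

variable {T} {ε} in
lemma ae_estimateQ_calls {c : ℕ} (h : ∀ s, ∀ᵐ x ∂T s, x.2 = c) (s : S) :
    ∀ᵐ q ∂estimateQ P E lo δ' T ε s, q.2 = P.callsQ δ' c ε := by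
  rw [estimateQ_apply, ae_map_iff (measurable_clippedMeans lo _).aemeasurable (measurableSet_snd_eq _)]
  have h2 : ∀ᵐ w ∂(Measure.pi fun i : Fin P.K × Fin (P.N δ' ε) => E.sampleQ P.γ T (s, i.1)),
      ∀ i, (w i).2 = c + 1 :=
    ae_all_iff.2 fun i => (Measure.quasiMeasurePreserving_eval
      (fun i : Fin P.K × Fin (P.N δ' ε) => E.sampleQ P.γ T (s, i.1)) i).ae
      (E.ae_sampleQ_calls h (s, i.1))
  filter_upwards [h2] with w hw
  simp [clippedMeans, hw, Params.callsQ]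

end EstimateQ

section SampleV

variable {ε : ℝ}

lemma sampleV_of_cap_le (h : P.cap ≤ ε) :
    sampleV P E lo δ' ε = Kernel.const S (Measure.dirac (0, 0)) := by
  rw [sampleV, dif_pos (Or.inr h)]

lemma sampleV_of_kappa_le (hε : 0 < ε) (hc : ε < P.cap) (hk : P.kappa ≤ ε) :
    sampleV P E lo δ' ε =
      E.evalStep (estimateQ P E lo δ' (sampleV P E lo δ' (P.relax ε)) ε) := by
  rw [sampleV, dif_neg (by push Not; exact ⟨hε, hc⟩), dif_pos hk]
  rfl

lemma sampleV_of_lt_kappa (hε : 0 < ε) (hc : ε < P.cap) (hk : ε < P.kappa) :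
    sampleV P E lo δ' ε =
      E.linStep (estimateQ P E lo δ' (sampleV P E lo δ' (P.relax √(P.kappa * ε))) √(P.kappa * ε))
        (E.sampleQ P.γ (sampleV P E lo δ' (P.relax ε))) := by
  rw [sampleV, dif_neg (by push Not; exact ⟨hε, hc⟩), dif_neg hk.not_ge]
  rfl

lemma smoothCruiser_eq : smoothCruiser P E lo δ' ε =
    E.evalStep (estimateQ P E lo δ' (sampleV P E lo δ' (P.relax ε)) ε) := rfl

variable [IsMarkovKernel E.draw]

lemma isMarkovKernel_sampleV (hε : 0 < ε) : IsMarkovKernel (sampleV P E lo δ' ε) := by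
  refine P.accuracy_induction (p := fun ε => IsMarkovKernel (sampleV P E lo δ' ε))
    (fun ε hc => ?_) (fun ε hε hc hk ih => ?_) (fun ε hε hc hk ih ih' => ?_) hε
  · rw [sampleV_of_cap_le E lo δ' hc]
    infer_instance
  · rw [sampleV_of_kappa_le E lo δ' hε hc hk]
    infer_instance
  · rw [sampleV_of_lt_kappa E lo δ' hε hc hk]
    infer_instance

omit [IsMarkovKernel E.draw] in
lemma ae_evalStep_calls {G : Kernel S ((Fin P.K → ℝ) × ℕ)} [IsMarkovKernel G] {s : S} {n : ℕ}
    (h : ∀ᵐ q ∂G s, q.2 = n) : ∀ᵐ x ∂E.evalStep G s, x.2 = n := by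
  exact (ae_evalStep_iff E G (p := fun x => x.2 = n)
    (measurableSet_snd_eq n) s).2 h

/-- Branches and sample sizes depend on the parameters, `ε` and `δ'`, never on sampled data. -/
lemma ae_sampleV_calls (hε : 0 < ε) (s : S) :
    ∀ᵐ x ∂sampleV P E lo δ' ε s, x.2 = P.callsV δ' ε := by
  refine P.accuracy_induction
    (p := fun ε => ∀ s, ∀ᵐ x ∂sampleV P E lo δ' ε s, x.2 = P.callsV δ' ε)
    (fun ε hc s => ?_) (fun ε hε hc hk ih s => ?_) (fun ε hε hc hk ih ih' s => ?_) hε s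
  · rw [sampleV_of_cap_le E lo δ' hc, Params.callsV_of_cap_le δ' hc, Kernel.const_apply,
      ae_dirac_iff (measurableSet_snd_eq 0)]
  · have := E.isMarkovKernel_sampleV lo δ' (P.relax_pos hε)
    rw [sampleV_of_kappa_le E lo δ' hε hc hk, Params.callsV_of_kappa_le δ' hε hc hk]
    exact E.ae_evalStep_calls (E.ae_estimateQ_calls lo δ' ih s)
  · have hκ := P.kappa_pos
    have := E.isMarkovKernel_sampleV lo δ' (P.relax_pos hε)
    have := E.isMarkovKernel_sampleV lo δ' (P.relax_pos (ε := √(P.kappa * ε)) (by positivity))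
    rw [sampleV_of_lt_kappa E lo δ' hε hc hk, Params.callsV_of_lt_kappa δ' hε hc hk]
    refine E.ae_linStep _ _ (measurableSet_snd_eq _) ?_
    filter_upwards [E.ae_estimateQ_calls lo δ' ih s] with q hq a
    filter_upwards [E.ae_sampleQ_calls ih' (s, a)] with v hv
    rw [hq, hv]

lemma isMarkovKernel_smoothCruiser (hε : 0 < ε) : IsMarkovKernel (smoothCruiser P E lo δ' ε) := by
  have := E.isMarkovKernel_sampleV lo δ' (P.relax_pos hε)
  rw [smoothCruiser_eq]
  infer_instance

lemma ae_smoothCruiser_calls (hε : 0 < ε) (s : S) :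
    ∀ᵐ x ∂smoothCruiser P E lo δ' ε s, x.2 = P.calls ε δ' := by
  have := E.isMarkovKernel_sampleV lo δ' (P.relax_pos hε)
  rw [smoothCruiser_eq]
  exact E.ae_evalStep_calls
    (E.ae_estimateQ_calls lo δ' (E.ae_sampleV_calls lo δ' (P.relax_pos hε)) s)

end SampleV

end Env

/-! ## Concentration of the estimates -/

section Hoeffding

variable {α ι : Type*} [MeasurableSpace α] [Fintype ι] {n : ℕ} (ν : ι → Measure α)
  [∀ i, IsProbabilityMeasure (ν i)] {e : Fin n → ι} {f : α → ℝ} {a b m t : ℝ}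

/-- Hoeffding's inequality for the factors selected by `e`. The product will carry the samples of
all actions, and `e` picks those of one action. -/
lemma measure_pi_sum_sub_ge_le (he : Function.Injective e) (hf : Measurable f)
    (hb : ∀ k, ∀ᵐ x ∂ν (e k), f x ∈ Set.Icc a b) (hm : ∀ k, ∫ x, f x ∂ν (e k) = m) (ht : 0 ≤ t) :
    (Measure.pi ν).real {w | n * t ≤ ∑ k, (f (w (e k)) - m)} ≤
      Real.exp (-(2 * n * t ^ 2 / (b - a) ^ 2)) := by
  have hind : iIndepFun (fun k (w : ι → α) => f (w (e k)) - m) (Measure.pi ν) :=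
    (iIndepFun_pi (μ := ν) (X := fun _ x => f x - m)
      (fun _ => (hf.sub_const m).aemeasurable)).precomp he
  have hsub : ∀ k ∈ (Finset.univ : Finset (Fin n)),
      HasSubgaussianMGF (fun w : ι → α => f (w (e k)) - m) ((‖b - a‖₊ / 2) ^ 2)
        (Measure.pi ν) := by
    intro k _
    have h := hasSubgaussianMGF_of_mem_Icc hf.aemeasurable (hb k)
    rw [hm k, ← (measurePreserving_eval ν (e k)).map_eq] at h
    exact HasSubgaussianMGF.of_map (X := fun x => f x - m) 
      (Y := Function.eval (e k)) (μ := Measure.pi ν)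
      (measurable_pi_apply (e k)).aemeasurable h
  have h := HasSubgaussianMGF.measure_sum_ge_le_of_iIndepFun hind hsub
    (mul_nonneg (Nat.cast_nonneg n) ht)
  refine h.trans (Real.exp_le_exp.2 (le_of_eq ?_))
  simp only [Finset.sum_const, Finset.card_univ, Fintype.card_fin, nsmul_eq_mul]
  push_cast
  rw [Real.norm_eq_abs, div_pow, sq_abs]
  -- If `n = 0` or `a = b`, both exponents are zero, because division by zero gives zero.
  rcases Nat.eq_zero_or_pos n with rfl | hn
  · simp
  have : (n : ℝ) ≠ 0 := by positivity
  by_cases hab : b - a = 0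
  · simp [hab]
  field_simp

lemma measure_pi_abs_mean_sub_ge_le (hn : 0 < n) (he : Function.Injective e) (hf : Measurable f)
    (hb : ∀ k, ∀ᵐ x ∂ν (e k), f x ∈ Set.Icc a b) (hm : ∀ k, ∫ x, f x ∂ν (e k) = m) (ht : 0 ≤ t) :
    (Measure.pi ν).real {w | t ≤ |(∑ k, f (w (e k))) / n - m|} ≤
      2 * Real.exp (-(2 * n * t ^ 2 / (b - a) ^ 2)) := by
  have h1 := measure_pi_sum_sub_ge_le ν he hf hb hm ht
  have h2 := measure_pi_sum_sub_ge_le ν (f := fun x => -f x) (a := -b) (b := -a) (m := -m) he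
    hf.neg (fun k => by
      filter_upwards [hb k] with x hx
      exact ⟨neg_le_neg hx.2, neg_le_neg hx.1⟩) (fun k => by rw [integral_neg, hm k]) ht
  rw [show -a - -b = b - a by ring] at h2
  rw [two_mul]
  refine (measureReal_mono (fun w hw => ?_)).trans
    ((measureReal_union_le _ _).trans (add_le_add h1 h2))
  have hn' : (0 : ℝ) < n := Nat.cast_pos.2 hn
  have hs : ∑ k, (f (w (e k)) - m) = n * ((∑ k, f (w (e k))) / n - m) := by
    rw [Finset.sum_sub_distrib, mul_sub, mul_div_cancel₀ _ hn'.ne']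
    simp
  have hs' : ∑ k, (-f (w (e k)) - -m) = n * -((∑ k, f (w (e k))) / n - m) := by
    rw [mul_neg, ← hs, ← Finset.sum_neg_distrib]
    exact Finset.sum_congr rfl fun _ _ => by ring
  rcases le_abs.1 (show t ≤ |(∑ k, f (w (e k))) / n - m| from hw) with h | h
  · left
    show n * t ≤ ∑ k, (f (w (e k)) - m)
    rw [hs]
    exact mul_le_mul_of_nonneg_left h hn'.le
  · right
    show n * t ≤ ∑ k, (-f (w (e k)) - -m)
    rw [hs']
    exact mul_le_mul_of_nonneg_left h hn'.le

end Hoeffding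

namespace Params

variable (P : Params)

/-- A bound on the outputs of `sampleV` as long as all estimates are accurate. -/
noncomputable def range : ℝ := 3 * P.cap / (1 - P.γ)

lemma range_nonneg : 0 ≤ P.range := by
  have := P.one_sub_pos
  have := P.cap_pos
  unfold range
  positivity

/-- The left side bounds an output of the linearized branch: `M + cap` for `F(q)`, `cap` for
`qᵀ∇F(q)`, and `1 + γ * range` for the weighted sample. -/
lemma range_rec : P.M + 2 * P.cap + (1 + P.γ * P.range) ≤ P.range := by
  have h := P.one_sub_pos
  have h1 := P.one_add_le_cap
  have h2 : P.range = 3 * P.cap + P.γ * P.range := by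
    unfold range
    field_simp
    ring
  linarith

/-- The left side is the length of the interval that contains the samples `R + γ v`. -/
lemma one_add_two_mul_range_le : 1 + 2 * P.γ * P.range ≤ 6 * P.cap / (1 - P.γ) := by
  have h := P.one_sub_pos
  have h1 := P.one_le_cap
  have h2 : 6 * P.cap / (1 - P.γ) = 6 * P.cap + 2 * P.γ * P.range := by
    unfold range
    field_simp
    ring
  linarith

lemma gamma_mul_relax (ε : ℝ) : P.γ * P.relax ε = √P.γ * ε := by
  unfold relax
  split_ifs with h
  · simp [h]
  · have h0 : 0 < √P.γ := Real.sqrt_pos.2 (lt_of_le_of_ne P.γ_nonneg (Ne.symm h))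
    nth_rewrite 1 [← Real.mul_self_sqrt P.γ_nonneg]
    field_simp

variable {P} {δ' ε : ℝ}

lemma log_pos (hδ : 0 < δ') (hδ' : δ' < 2 * P.K) : 0 < Real.log (2 * P.K / δ') :=
  Real.log_pos (by rwa [one_lt_div hδ])

lemma N_pos (hδ : 0 < δ') (hδ' : δ' < 2 * P.K) (hε : 0 < ε) : 0 < P.N δ' ε := by
  have := log_pos hδ hδ'
  have := P.one_sub_pos
  have := P.sqrt_lt_one
  have := P.M_nonneg
  have : 0 < 1 - √P.γ := by linarith
  exact Nat.ceil_pos.2 (by positivity)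

/-- `N` is made for this Hoeffding bound, with deviation `(1 - √γ) ε` and length at most `6 cap / (1
- γ)`; the constant is `18 = 6² / 2`. The share `δ' / K` anticipates a union bound over the actions.
-/
lemma two_mul_exp_le (hδ : 0 < δ') (hε : 0 < ε) :
    2 * Real.exp (-(2 * P.N δ' ε * ((1 - √P.γ) * ε) ^ 2 / (1 + 2 * P.γ * P.range) ^ 2)) ≤
      δ' / P.K := by
  have hK : (0 : ℝ) < P.K := Nat.cast_pos.2 P.K_pos
  have hg := P.one_sub_pos
  have hs : 0 < 1 - √P.γ := sub_pos.2 P.sqrt_lt_one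
  have hc := P.cap_pos
  have hr0 : 0 < 1 + 2 * P.γ * P.range := by
    have := mul_nonneg P.γ_nonneg P.range_nonneg
    linarith
  have hr : (1 + 2 * P.γ * P.range) ^ 2 ≤ (6 * P.cap / (1 - P.γ)) ^ 2 := by
    have := P.one_add_two_mul_range_le
    gcongr
  have hN : 18 * (1 + P.M) ^ 2 / ((1 - P.γ) ^ 4 * (1 - √P.γ) ^ 2) *
      (Real.log (2 * P.K / δ') / ε ^ 2) ≤ P.N δ' ε := Nat.le_ceil _
  have h1 : Real.log (2 * P.K / δ') ≤
      2 * P.N δ' ε * ((1 - √P.γ) * ε) ^ 2 / (6 * P.cap / (1 - P.γ)) ^ 2 := by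
    have hM : 1 + P.M = P.cap * (1 - P.γ) := by
      unfold cap
      field_simp
    rw [hM] at hN
    rw [le_div_iff₀ (by positivity)]
    have h2 := mul_le_mul_of_nonneg_right hN
      (show 0 ≤ 2 * ((1 - √P.γ) * ε) ^ 2 by positivity)
    calc _ = _ := ?_
      _ ≤ _ := h2
      _ = _ := by ring
    field_simp
    ring
  have h2 : 2 * P.N δ' ε * ((1 - √P.γ) * ε) ^ 2 / (6 * P.cap / (1 - P.γ)) ^ 2 ≤
      2 * P.N δ' ε * ((1 - √P.γ) * ε) ^ 2 / (1 + 2 * P.γ * P.range) ^ 2 := by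
    gcongr
  have h3 : Real.exp (-(2 * P.N δ' ε * ((1 - √P.γ) * ε) ^ 2 / (1 + 2 * P.γ * P.range) ^ 2)) ≤
      Real.exp (-Real.log (2 * P.K / δ')) := Real.exp_le_exp.2 (by linarith)
  rw [Real.exp_neg (Real.log _), Real.exp_log (by positivity)] at h3
  calc _ ≤ 2 * (2 * P.K / δ')⁻¹ := by linarith
    _ = δ' / P.K := by field_simp

end Params

namespace Env

variable {S : Type u} [MeasurableSpace S] {P : Params} {E : Env S P.K} {V : S → ℝ} {lo δ' ε : ℝ}

/-- The outputs of `T` are bounded estimates of `V` with bias at most `ε`. -/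
structure Accurate (P : Params) (V : S → ℝ) (ε : ℝ) (T : Kernel S (ℝ × ℕ)) : Prop where
  bound : ∀ s, ∀ᵐ x ∂T s, |x.1| ≤ P.range
  bias : ∀ s, |∫ x, x.1 ∂T s - V s| ≤ ε

namespace Accurate

variable {T : Kernel S (ℝ × ℕ)} [IsMarkovKernel T]

lemma sampleQ_mem (h : Accurate P V ε T) (p : S × Fin P.K) :
    ∀ᵐ x ∂E.sampleQ P.γ T p, x.1 ∈ Set.Icc (-(P.γ * P.range)) (1 + P.γ * P.range) := by
  refine (ae_sampleQ_iff E P.γ T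
    (p := fun x => x.1 ∈ Set.Icc (-(P.γ * P.range)) (1 + P.γ * P.range))
    (measurable_fst measurableSet_Icc) p).2 ?_
  filter_upwards [E.reward_mem p] with o ho
  filter_upwards [h.bound o.2] with v hv
  have h1 := abs_le.1 hv
  have h2 := mul_le_mul_of_nonneg_left h1.1 P.γ_nonneg
  have h3 := mul_le_mul_of_nonneg_left h1.2 P.γ_nonneg
  exact ⟨by linarith [ho.1], by linarith [ho.2]⟩

lemma integrable_sampleQ (h : Accurate P V ε T) (p : S × Fin P.K) :
    Integrable (fun x => x.1) (E.sampleQ P.γ T p) :=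
  Integrable.of_mem_Icc _ _ measurable_fst.aemeasurable (h.sampleQ_mem p)

/-- The mean output of `T` is a bounded measurable function of the state, and the mean of `sampleQ`
is its `Q`-value. So the bias contracts by `γ`. -/
lemma abs_integral_sampleQ_sub_le (h : Accurate P V ε T) (hV : Measurable V)
    {B : ℝ} (hB : ∀ s, |V s| ≤ B) (s : S) (a : Fin P.K) :
    |∫ x, x.1 ∂E.sampleQ P.γ T (s, a) - E.qValue P.γ V s a| ≤ P.γ * ε := by
  have hint : ∀ s, Integrable (fun x => x.1) (T s) := fun s =>
    Integrable.of_bound measurable_fst.aestronglyMeasurable P.range (h.bound s)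
  have hW : Measurable fun s => ∫ x, x.1 ∂T s :=
    (StronglyMeasurable.integral_kernel measurable_fst.stronglyMeasurable).measurable
  have hWB : ∀ s, |∫ x, x.1 ∂T s| ≤ P.range := fun s => by
    simpa using norm_integral_le_of_norm_le_const (f := fun x : ℝ × ℕ => x.1) (h.bound s)
  have h1 : ∫ x, x.1 ∂E.sampleQ P.γ T (s, a)
      = E.qValue P.γ (fun s => ∫ x, x.1 ∂T s) s a := by
    rw [integral_sampleQ E P.γ T measurable_fst (h.integrable_sampleQ _), qValue]
    refine integral_congr_ae (Eventually.of_forall fun o => ?_)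
    show ∫ v, (o.1 + P.γ * v.1) ∂T o.2 = _
    rw [integral_add (integrable_const _) ((hint _).const_mul _), integral_const_mul]
    simp
  rw [h1]
  exact E.abs_qValue_sub_le P.γ_nonneg hW hV hWB hB h.bias s a

end Accurate

lemma abs_clip_sub_le {x y lo hi : ℝ} (h1 : lo ≤ y) (h2 : y ≤ hi) :
    |min hi (max lo x) - y| ≤ |x - y| := by
  have h3 : min hi (max lo y) = y := by rw [max_eq_right h1, min_eq_right h2]
  nth_rewrite 1 [← h3]
  refine (abs_min_sub_min_le_max _ _ _ _).trans ?_
  rw [sub_self, abs_zero]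
  refine max_le (abs_nonneg _) ((abs_max_sub_max_le_max _ _ _ _).trans ?_)
  simp

/-- The estimates `q` of the `Q`-values at `s` with an error above `ε` for some action. -/
def badEstimates (E : Env S P.K) (V : S → ℝ) (ε : ℝ) (s : S) : Set ((Fin P.K → ℝ) × ℕ) :=
  {q | ∃ a, ε < |q.1 a - E.qValue P.γ V s a|}

/-- Clipping cannot increase an error, as the true value lies in the clipping interval. The samples
have bias at most `√γ ε`, so an error above `ε` forces a mean to deviate from its expectation by at
least `(1 - √γ) ε`. -/
lemma estimateQ_badEstimates_le (h : E.IsSmooth P.L P.M) (hV : E.IsValue P.γ V)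
    (hlo : E.ClipLevel P V lo) (hδ : 0 < δ') (hδ' : δ' < 2 * P.K) (hε : 0 < ε)
    {T : Kernel S (ℝ × ℕ)} [IsMarkovKernel T] (hT : Accurate P V (P.relax ε) T) (s : S) :
    estimateQ P E lo δ' T ε s (E.badEstimates V ε s) ≤ ENNReal.ofReal δ' := by
  set ν : Fin P.K × Fin (P.N δ' ε) → Measure (ℝ × ℕ) := fun i => E.sampleQ P.γ T (s, i.1)
  have hbad : MeasurableSet (E.badEstimates V ε s) := by
    rw [show E.badEstimates V ε s = ⋃ a, {q | ε < |q.1 a - E.qValue P.γ V s a|} by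
      ext q; simp [badEstimates]]
    refine MeasurableSet.iUnion fun a => measurableSet_lt measurable_const ?_
    exact (((measurable_pi_apply a).comp measurable_fst).sub_const _).abs
  rw [estimateQ_apply, Measure.map_apply (measurable_clippedMeans lo _) hbad]
  have hK : (0 : ℝ) < P.K := Nat.cast_pos.2 P.K_pos
  have ht : 0 ≤ (1 - √P.γ) * ε := mul_nonneg (sub_nonneg.2 P.sqrt_lt_one.le) hε.le
  have hsub : clippedMeans P lo (P.N δ' ε) ⁻¹' E.badEstimates V ε s ⊆
      ⋃ a : Fin P.K, {w | (1 - √P.γ) * ε ≤ |(∑ k : Fin (P.N δ' ε), (w (a, k)).1) / P.N δ' ε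
        - ∫ x, x.1 ∂E.sampleQ P.γ T (s, a)|} := by
    rintro w ⟨a, ha⟩
    refine Set.mem_iUnion.2 ⟨a, ?_⟩
    have h1 := abs_clip_sub_le (x := (∑ k : Fin (P.N δ' ε), (w (a, k)).1) / P.N δ' ε)
      (hlo.le_qValue h hV s a) (abs_le.1 (hV.abs_qValue_le_cap h s a)).2
    have h2 := hT.abs_integral_sampleQ_sub_le (E := E) hV.measurable (hV.abs_le_cap h) s a
    rw [P.gamma_mul_relax] at h2
    have h3 := abs_sub_le ((∑ k : Fin (P.N δ' ε), (w (a, k)).1) / P.N δ' ε)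
      (∫ x, x.1 ∂E.sampleQ P.γ T (s, a)) (E.qValue P.γ V s a)
    have ha' := ha.trans_le h1
    rw [Set.mem_ofPred_eq]
    linarith
  refine (measure_mono hsub).trans ((measure_iUnion_fintype_le _ _).trans ?_)
  have hone : ∀ a : Fin P.K, Measure.pi ν {w | (1 - √P.γ) * ε ≤
      |(∑ k : Fin (P.N δ' ε), (w (a, k)).1) / P.N δ' ε
        - ∫ x, x.1 ∂E.sampleQ P.γ T (s, a)|} ≤ ENNReal.ofReal (δ' / P.K) := by
    intro a
    have := measure_pi_abs_mean_sub_ge_le ν (e := fun k : Fin (P.N δ' ε) => (a, k))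
      (f := fun x => x.1) (Params.N_pos hδ hδ' hε) (fun k k' hk => (Prod.mk.inj hk).2)
      measurable_fst (fun k => hT.sampleQ_mem (s, a)) (m := ∫ x, x.1 ∂E.sampleQ P.γ T (s, a)) (fun k => rfl) ht
    rw [show 1 + P.γ * P.range - -(P.γ * P.range) = 1 + 2 * P.γ * P.range by ring] at this
    rw [← ofReal_measureReal]
    exact ENNReal.ofReal_le_ofReal (this.trans (Params.two_mul_exp_le hδ hε))
  refine (Finset.sum_le_sum fun a _ => hone a).trans (le_of_eq ?_)
  rw [Finset.sum_const, Finset.card_univ, Fintype.card_fin, nsmul_eq_mul,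
    ← ENNReal.ofReal_natCast, ← ENNReal.ofReal_mul hK.le]
  congr 1
  field_simp

end Env

/-! ## Accuracy of the algorithm -/

lemma abs_integral_sub_le {α : Type*} [MeasurableSpace α] {μ : Measure α} [IsProbabilityMeasure μ]
    {f : α → ℝ} (hf : AEStronglyMeasurable f μ) {c ε : ℝ} (h : ∀ᵐ x ∂μ, |f x - c| ≤ ε) :
    |∫ x, f x ∂μ - c| ≤ ε := by
  have hi : Integrable f μ := Integrable.of_bound hf (|c| + ε) (by
    filter_upwards [h] with x hx
    calc ‖f x‖ = |c + (f x - c)| := by rw [Real.norm_eq_abs]; ring_nf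
      _ ≤ _ := (abs_add_le _ _).trans (add_le_add le_rfl hx))
  have h1 : ∫ x, f x ∂μ - c = ∫ x, (f x - c) ∂μ := by
    rw [integral_sub hi (integrable_const c)]
    simp
  rw [h1]
  simpa using norm_integral_le_of_norm_le_const (f := fun x => f x - c) h

namespace Env

variable {S : Type u} [MeasurableSpace S] {P : Params} {E : Env S P.K} {V : S → ℝ} {lo δ' ε : ℝ}

section Correct

open Classical in
/-- Replace an estimate of the `Q`-values at `s` by the true values if its error is above `ε` for
some action. -/
noncomputable def correctedEstimate (E : Env S P.K) (V : S → ℝ) (ε : ℝ)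
    (p : S × ((Fin P.K → ℝ) × ℕ)) : (Fin P.K → ℝ) × ℕ :=
  if ∃ a, ε < |p.2.1 a - E.qValue P.γ V p.1 a| then (E.qValue P.γ V p.1, p.2.2) else p.2

lemma measurableSet_bad (hV : Measurable V) :
    MeasurableSet {p : S × ((Fin P.K → ℝ) × ℕ) | ∃ a, ε < |p.2.1 a - E.qValue P.γ V p.1 a|} := by
  have hQ := E.measurable_qValue (γ := P.γ) hV
  rw [show {p : S × ((Fin P.K → ℝ) × ℕ) | ∃ a, ε < |p.2.1 a - E.qValue P.γ V p.1 a|}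
    = ⋃ a, {p | ε < |p.2.1 a - E.qValue P.γ V p.1 a|} by ext q; simp]
  exact MeasurableSet.iUnion fun a => measurableSet_lt measurable_const
    (((by fun_prop : Measurable fun p : S × ((Fin P.K → ℝ) × ℕ) => p.2.1 a)).sub
      ((measurable_pi_apply a).comp (hQ.comp measurable_fst))).abs

lemma measurable_correctedEstimate (hV : Measurable V) :
    Measurable (E.correctedEstimate V ε) :=
  Measurable.ite (measurableSet_bad hV)
    (((E.measurable_qValue hV).comp measurable_fst).prodMk (by fun_prop)) measurable_snd

/-- Correcting the outcome, rather than conditioning on a good one, moves only the mass of the bad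
set. -/
lemma exists_corrected (hV : Measurable V) (G : Kernel S ((Fin P.K → ℝ) × ℕ)) [IsMarkovKernel G] :
    ∃ G' : Kernel S ((Fin P.K → ℝ) × ℕ), IsMarkovKernel G' ∧
      (∀ s, Near (G s (E.badEstimates V ε s)) (G s) (G' s)) ∧
      ∀ s, G' s = (G s).map fun q => E.correctedEstimate V ε (s, q) := by
  have hm := measurable_correctedEstimate (E := E) (ε := ε) hV
  have happ : ∀ s, ((Kernel.id ×ₖ G).map (E.correctedEstimate V ε)) s
      = (G s).map fun q => E.correctedEstimate V ε (s, q) := fun s => by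
    rw [Kernel.map_apply _ hm, id_prod_eq_map, Measure.map_map hm measurable_prodMk_left]
    rfl
  refine ⟨(Kernel.id ×ₖ G).map (E.correctedEstimate V ε), Kernel.IsMarkovKernel.map _ hm,
    fun s => ?_, happ⟩
  rw [happ]
  have := Near.of_map_eq (μ := G s) (g := id) (h := fun q => E.correctedEstimate V ε (s, q))
    (A := E.badEstimates V ε s) measurable_id (hm.comp measurable_prodMk_left)
    (measurable_prodMk_left (measurableSet_bad hV)) (fun q hq => (if_neg hq).symm) le_rfl
  simpa using this

end Correct

/-- The estimates `q` of the `Q`-values at `s` are within `ε` of them, and bounded by the a-priori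
bound. -/
def IsGoodEstimate (E : Env S P.K) (V : S → ℝ) (ε : ℝ) (s : S) (q : Fin P.K → ℝ) : Prop :=
  ∀ a, |q a - E.qValue P.γ V s a| ≤ ε ∧ |q a| ≤ P.cap

lemma measurableSet_isGoodEstimate (s : S) :
    MeasurableSet {q : (Fin P.K → ℝ) × ℕ | E.IsGoodEstimate V ε s q.1} := by
  have h : ∀ a, Measurable fun q : (Fin P.K → ℝ) × ℕ => q.1 a := fun a => by fun_prop
  rw [show {q : (Fin P.K → ℝ) × ℕ | E.IsGoodEstimate V ε s q.1} =
    ⋂ a, {q | |q.1 a - E.qValue P.γ V s a| ≤ ε ∧ |q.1 a| ≤ P.cap} by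
      ext q; simp [IsGoodEstimate]]
  exact MeasurableSet.iInter fun a =>
    (measurableSet_le ((h a).sub_const _).abs measurable_const).inter
      (measurableSet_le (h a).abs measurable_const)

/-- A procedure that is close to `estimateQ` and returns good estimates surely. -/
lemma exists_good_estimateQ (h : E.IsSmooth P.L P.M) (hV : E.IsValue P.γ V)
    (hlo : E.ClipLevel P V lo) (hδ : 0 < δ') (hδ' : δ' < 2 * P.K) (hε : 0 < ε)
    {T T' : Kernel S (ℝ × ℕ)} [IsMarkovKernel T] [IsMarkovKernel T'] {c : ℕ}
    (hT : ∀ s, Near (ENNReal.ofReal (δ' * c)) (T s) (T' s))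
    (hT' : Accurate P V (P.relax ε) T') :
    ∃ G : Kernel S ((Fin P.K → ℝ) × ℕ), IsMarkovKernel G ∧
      (∀ s, Near (ENNReal.ofReal (δ' * P.callsQ δ' c ε)) (estimateQ P E lo δ' T ε s) (G s)) ∧
      ∀ s, ∀ᵐ q ∂G s, E.IsGoodEstimate V ε s q.1 := by
  obtain ⟨G, hG, hnear, happ⟩ := exists_corrected (E := E) (ε := ε) hV.measurable
    (estimateQ P E lo δ' T' ε)
  have hm : ∀ s, Measurable fun q => E.correctedEstimate V ε (s, q) := fun s =>
    (measurable_correctedEstimate hV.measurable).comp measurable_prodMk_left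
  refine ⟨G, hG, fun s => ?_, fun s => ?_⟩
  -- Exchanging `T` for `T'` in all `K N` samples costs `K N δ' c`; correcting the result costs
  -- `δ'`. Since `K N ≥ 1`, the sum is at most `δ' K N (c + 1)`.
  · refine ((E.near_estimateQ lo δ' ε hT s).trans
      ((hnear s).mono (estimateQ_badEstimates_le h hV hlo hδ hδ' hε hT' s))).mono ?_
    rw [← ENNReal.ofReal_natCast, ← ENNReal.ofReal_mul (by positivity),
      ← ENNReal.ofReal_add (by positivity) hδ.le]
    refine ENNReal.ofReal_le_ofReal ?_
    have h1 : (1 : ℝ) ≤ (P.K * P.N δ' ε : ℕ) :=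
      Nat.one_le_cast.2 (Nat.mul_pos P.K_pos (Params.N_pos hδ hδ' hε))
    have h2 : (P.callsQ δ' c ε : ℝ) = (P.K * P.N δ' ε : ℕ) * (c + 1) := by
      unfold Params.callsQ
      push_cast
      ring
    rw [h2]
    nlinarith
  · rw [happ, ae_map_iff (hm s).aemeasurable (measurableSet_isGoodEstimate s), estimateQ_apply]
    refine (ae_map_iff (measurable_clippedMeans lo _).aemeasurable
      (hm s (measurableSet_isGoodEstimate s))).2 (Eventually.of_forall fun w a => ?_)
    show |(E.correctedEstimate V ε (s, _)).1 a - _| ≤ ε ∧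
      |(E.correctedEstimate V ε (s, _)).1 a| ≤ P.cap
    unfold correctedEstimate
    split_ifs with hbad
    · exact ⟨by simpa using hε.le, hV.abs_qValue_le_cap h s a⟩
    · push Not at hbad
      refine ⟨hbad a, abs_le.2 ⟨?_, min_le_left _ _⟩⟩
      have := P.cap_pos
      exact le_min (by linarith) (hlo.neg_cap_le.trans (le_max_left _ _))

lemma IsGoodEstimate.abs_F_sub_le (h : E.IsSmooth P.L P.M) (hV : E.IsValue P.γ V) (hε : 0 ≤ ε)
    {s : S} {q : Fin P.K → ℝ} (hq : E.IsGoodEstimate V ε s q) : |E.F s q - V s| ≤ ε := by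
  rw [hV.bellman s]
  exact h.abs_sub_le s hε fun a => (hq a).1

lemma accurate_zero (h : E.IsSmooth P.L P.M) (hV : E.IsValue P.γ V) (hc : P.cap ≤ ε) :
    Accurate P V ε (Kernel.const S (Measure.dirac ((0 : ℝ), (0 : ℕ)))) := by
  refine ⟨fun s => ?_, fun s => ?_⟩
  · rw [Kernel.const_apply, ae_dirac_iff (measurableSet_le measurable_fst.abs measurable_const)]
    simpa using P.range_nonneg
  · rw [Kernel.const_apply, integral_dirac]
    simpa using (hV.abs_le_cap h s).trans hc

lemma accurate_evalStep (h : E.IsSmooth P.L P.M) (hV : E.IsValue P.γ V) (hε : 0 < ε)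
    {G : Kernel S ((Fin P.K → ℝ) × ℕ)} [IsMarkovKernel G]
    (hG : ∀ s, ∀ᵐ q ∂G s, E.IsGoodEstimate V ε s q.1) : Accurate P V ε (E.evalStep G) := by
  refine ⟨fun s => ?_, fun s => abs_integral_sub_le measurable_fst.aestronglyMeasurable ?_⟩
  · refine (ae_evalStep_iff E G (p := fun x => |x.1| ≤ P.range)
      (measurableSet_le measurable_fst.abs measurable_const) s).2 ?_
    filter_upwards [hG s] with q hq
    have h1 := h.abs_le s P.cap_pos.le fun a => (hq a).2
    have h2 := P.range_rec
    have h3 := mul_nonneg P.γ_nonneg P.range_nonneg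
    have h4 := P.cap_pos
    show |E.F s q.1| ≤ _
    linarith
  · refine (ae_evalStep_iff E G (p := fun x => |x.1 - V s| ≤ ε)
      (measurableSet_le (measurable_fst.sub_const _).abs measurable_const) s).2 ?_
    filter_upwards [hG s] with q hq
    exact hq.abs_F_sub_le h hV hε.le

/-- Importance weighting: the factor `gradNorm` cancels the normalization of the action's law. -/
lemma integral_draw (h : E.IsSmooth P.L P.M) (s : S) (x : Fin P.K → ℝ) (b : ℝ)
    (f : Fin P.K → ℝ) :
    ∫ a, (b + f a * E.gradNorm s x) ∂E.draw (s, x) = b + ∑ a, f a * E.grad s x a := by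
  have hg := h.gradNorm_pos s x
  have h1 := integral_sum_dirac
    (p := fun a => E.grad s x a / E.gradNorm s x)
    (fun a => div_nonneg (h.grad_nonneg s x a) hg.le) fun a => b + f a * E.gradNorm s x
  refine Eq.trans h1 ?_
  have h2 : ∀ a, E.grad s x a / E.gradNorm s x * (b + f a * E.gradNorm s x)
      = b / E.gradNorm s x * E.grad s x a + f a * E.grad s x a := fun a => by
    field_simp
  simp_rw [h2]
  rw [Finset.sum_add_distrib, ← Finset.mul_sum, ← h.gradNorm_eq, div_mul_cancel₀ _ hg.ne']

/-- Given `q`, the mean output is `F(q) + (Q - q)ᵀ∇F(q) + (m - Q)ᵀ∇F(q)`, with `m` the means of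
`sampleQ`. The first two terms miss `F(Q) = V(s)` by the Taylor remainder, and the last is the
recursive bias. -/
lemma accurate_linStep (h : E.IsSmooth P.L P.M) (hV : E.IsValue P.γ V) (hε : 0 < ε)
    [IsMarkovKernel E.draw] {G : Kernel S ((Fin P.K → ℝ) × ℕ)} [IsMarkovKernel G]
    (hG : ∀ s, ∀ᵐ q ∂G s, E.IsGoodEstimate V √(P.kappa * ε) s q.1)
    {T : Kernel S (ℝ × ℕ)} [IsMarkovKernel T] (hT : Accurate P V (P.relax ε) T) :
    Accurate P V ε (E.linStep G (E.sampleQ P.γ T)) := by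
  have hb : ∀ s, ∀ᵐ x ∂E.linStep G (E.sampleQ P.γ T) s, |x.1| ≤ P.range := by
    intro s
    refine ae_linStep E G _ (p := fun x => |x.1| ≤ P.range)
      (measurableSet_le measurable_fst.abs measurable_const) ?_
    filter_upwards [hG s] with q hq a
    filter_upwards [hT.sampleQ_mem (E := E) (s, a)] with v hv
    have h1 := h.abs_le s P.cap_pos.le fun a => (hq a).2
    have h2 := h.abs_sum_mul_grad_le s q.1 q.1 P.cap_pos.le fun a => (hq a).2
    have h3 : |v.1 * E.gradNorm s q.1| ≤ 1 + P.γ * P.range := by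
      have h0 := mul_nonneg P.γ_nonneg P.range_nonneg
      rw [abs_mul, abs_of_pos (h.gradNorm_pos s q.1)]
      exact (mul_le_of_le_one_right (abs_nonneg _) (h.gradNorm_le s q.1)).trans
        (abs_le.2 ⟨by linarith [hv.1], hv.2⟩)
    have h4 := P.range_rec
    have h5 := abs_le.1 h1
    have h6 := abs_le.1 h2
    have h7 := abs_le.1 h3
    exact abs_le.2 ⟨by linarith, by linarith⟩
  refine ⟨hb, fun s => ?_⟩
  set m : Fin P.K → ℝ := fun a => ∫ x, x.1 ∂E.sampleQ P.γ T (s, a) with hm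
  have hgr : ∀ a, Measurable fun q : (Fin P.K → ℝ) × ℕ => E.grad s q.1 a := fun a =>
    (E.measurable_grad a).comp
      (by fun_prop : Measurable fun q : (Fin P.K → ℝ) × ℕ => (s, q.1))
  have hF : Measurable fun q : (Fin P.K → ℝ) × ℕ => E.F s q.1 :=
    E.measurable_F.comp (by fun_prop : Measurable fun q : (Fin P.K → ℝ) × ℕ => (s, q.1))
  have h1 : ∫ x, x.1 ∂E.linStep G (E.sampleQ P.γ T) s =
      ∫ q, (E.F s q.1 - ∑ a, q.1 a * E.grad s q.1 a + ∑ a, m a * E.grad s q.1 a) ∂G s := by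
    rw [integral_linStep E G _ measurable_fst
      (Integrable.of_bound measurable_fst.aestronglyMeasurable P.range (hb s))]
    refine integral_congr_ae (Eventually.of_forall fun q => ?_)
    simp only
    rw [← integral_draw h]
    refine integral_congr_ae (Eventually.of_forall fun a => ?_)
    simp only
    rw [integral_add (integrable_const _) ((hT.integrable_sampleQ _).mul_const _),
      integral_mul_const]
    simp [hm]
  rw [h1]
  refine abs_integral_sub_le (Measurable.aestronglyMeasurable ?_) ?_
  · exact (hF.sub (Finset.measurable_sum _ fun a _ =>
      ((measurable_pi_apply a).comp measurable_fst).mul (hgr a))).add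
      (Finset.measurable_sum _ fun a _ => (hgr a).const_mul _)
  filter_upwards [hG s] with q hq
  rw [hV.bellman s]
  set Q := E.qValue P.γ V s
  have hκ := P.kappa_pos
  -- `K` squared errors of at most `κε` each, times `L`: the threshold `κ` makes this exactly `(1 -
  -- √γ) ε`.
  have h2 : |E.F s Q - E.F s q.1 - ∑ a, (Q a - q.1 a) * E.grad s q.1 a| ≤ (1 - √P.γ) * ε := by
    refine (h.smooth s Q q.1).trans ?_
    have h3 : ∑ a, (Q a - q.1 a) ^ 2 ≤ ∑ _ : Fin P.K, P.kappa * ε :=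
      Finset.sum_le_sum fun a _ => by
        rw [← Real.sq_sqrt (show 0 ≤ P.kappa * ε by positivity), ← sq_abs, abs_sub_comm]
        exact pow_le_pow_left₀ (abs_nonneg _) (hq a).1 2
    refine (mul_le_mul_of_nonneg_left h3 P.L_pos.le).trans (le_of_eq ?_)
    have := P.L_pos
    have : (0 : ℝ) < P.K := Nat.cast_pos.2 P.K_pos
    rw [Finset.sum_const, Finset.card_univ, Fintype.card_fin, nsmul_eq_mul, Params.kappa]
    field_simp
  have h4 : |∑ a, (m a - Q a) * E.grad s q.1 a| ≤ √P.γ * ε := by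
    have h0 : 0 ≤ √P.γ * ε := by positivity
    refine h.abs_sum_mul_grad_le s q.1 (fun a => m a - Q a) h0 fun a => ?_
    rw [← P.gamma_mul_relax]
    exact hT.abs_integral_sampleQ_sub_le hV.measurable (hV.abs_le_cap h) s a
  simp only [sub_mul, Finset.sum_sub_distrib] at h2 h4
  have h5 := abs_le.1 h2
  have h6 := abs_le.1 h4
  exact abs_le.2 ⟨by linarith, by linarith⟩

/-- A procedure that is close to `sampleV(·, ε)`, with bounded outputs and bias at most `ε`. -/
lemma exists_accurate_sampleV (h : E.IsSmooth P.L P.M) (hV : E.IsValue P.γ V)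
    (hlo : E.ClipLevel P V lo) (hδ : 0 < δ') (hδ' : δ' < 2 * P.K) (hε : 0 < ε) :
    ∃ T : Kernel S (ℝ × ℕ), IsMarkovKernel T ∧
      (∀ s, Near (ENNReal.ofReal (δ' * P.callsV δ' ε)) (sampleV P E lo δ' ε s) (T s)) ∧
      Accurate P V ε T := by
  have hdraw := h.isMarkovKernel_draw
  refine P.accuracy_induction (p := fun ε => ∃ T : Kernel S (ℝ × ℕ), IsMarkovKernel T ∧
      (∀ s, Near (ENNReal.ofReal (δ' * P.callsV δ' ε)) (sampleV P E lo δ' ε s) (T s)) ∧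
      Accurate P V ε T)
    (fun ε hc => ?_) (fun ε hε hc hk ih => ?_) (fun ε hε hc hk ih ih' => ?_) hε
  · refine ⟨_, inferInstance, fun s => ?_, accurate_zero h hV hc⟩
    rw [sampleV_of_cap_le E lo δ' hc]
    exact Near.refl _ _
  · obtain ⟨T, hTm, hTn, hT⟩ := ih
    have := E.isMarkovKernel_sampleV lo δ' (P.relax_pos hε)
    obtain ⟨G, hGm, hGn, hG⟩ := exists_good_estimateQ h hV hlo hδ hδ' hε hTn hT
    refine ⟨E.evalStep G, inferInstance, fun s => ?_, accurate_evalStep h hV hε hG⟩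
    rw [sampleV_of_kappa_le E lo δ' hε hc hk, Params.callsV_of_kappa_le δ' hε hc hk]
    exact E.near_evalStep (hGn s)
  · obtain ⟨T, hTm, hTn, hT⟩ := ih
    obtain ⟨T', hTm', hTn', hT'⟩ := ih'
    have hκ := P.kappa_pos
    have he : 0 < √(P.kappa * ε) := by positivity
    have := E.isMarkovKernel_sampleV lo δ' (P.relax_pos hε)
    have := E.isMarkovKernel_sampleV lo δ' (P.relax_pos he)
    obtain ⟨G, hGm, hGn, hG⟩ := exists_good_estimateQ h hV hlo hδ hδ' he hTn hT
    refine ⟨E.linStep G (E.sampleQ P.γ T'), inferInstance, fun s => ?_,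
      accurate_linStep h hV hε hG hT'⟩
    rw [sampleV_of_lt_kappa E lo δ' hε hc hk, Params.callsV_of_lt_kappa δ' hε hc hk]
    refine (E.near_linStep (hGn s) fun p => E.near_sampleQ P.γ hTn' p).mono ?_
    rw [← ENNReal.ofReal_add (by positivity) (by positivity)]
    refine ENNReal.ofReal_le_ofReal ?_
    push_cast
    nlinarith

lemma smoothCruiser_error_le (h : E.IsSmooth P.L P.M) (hV : E.IsValue P.γ V)
    (hlo : E.ClipLevel P V lo) (hδ : 0 < δ') (hδ' : δ' < 2 * P.K) (hε : 0 < ε) (s : S) :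
    smoothCruiser P E lo δ' ε s {o | ε < |o.1 - V s|} ≤
      ENNReal.ofReal (δ' * P.calls ε δ') := by
  have hdraw := h.isMarkovKernel_draw
  obtain ⟨T, hTm, hTn, hT⟩ := exists_accurate_sampleV h hV hlo hδ hδ' (P.relax_pos hε)
  have := E.isMarkovKernel_sampleV lo δ' (P.relax_pos hε)
  obtain ⟨G, hGm, hGn, hG⟩ := exists_good_estimateQ h hV hlo hδ hδ' hε hTn hT
  rw [smoothCruiser_eq]
  refine ((E.near_evalStep (hGn s)).measure_le
    (measurableSet_lt measurable_const (measurable_fst.sub_const _).abs)).trans ?_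
  have h0 : E.evalStep G s {o | ε < |o.1 - V s|} = 0 := by
    have h1 : ∀ᵐ x ∂E.evalStep G s, |x.1 - V s| ≤ ε := by
      refine (ae_evalStep_iff E G (p := fun x => |x.1 - V s| ≤ ε)
        (measurableSet_le (measurable_fst.sub_const _).abs measurable_const) s).2 ?_
      filter_upwards [hG s] with q hq
      exact hq.abs_F_sub_le h hV hε.le
    rw [ae_iff] at h1
    simpa only [not_le] using h1
  rw [h0, zero_add]
  rfl

end Env

/-! ## Sample complexity -/

lemma add_one_le_mul_exp {s x : ℝ} (hs : 0 < s) (hx : 0 ≤ x) :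
    x + 1 ≤ (1 + 1 / s) * Real.exp (s * x) := by
  have h1 := Real.add_one_le_exp (s * x)
  have h2 : x ≤ 1 / s * Real.exp (s * x) := by
    rw [one_div, inv_mul_eq_div, le_div_iff₀ hs]
    linarith
  have h3 : 1 ≤ Real.exp (s * x) := Real.one_le_exp (by positivity)
  linarith

lemma exists_add_one_pow_le_mul_exp {s : ℝ} (hs : 0 < s) (d : ℕ) :
    ∃ D, 0 < D ∧ ∀ x, 0 ≤ x → (x + 1) ^ d ≤ D * Real.exp (s * x) := by
  -- The rate `s / (d + 1)` in place of `s / d` covers `d = 0`.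
  have hr : 0 < s / (d + 1) := by positivity
  refine ⟨(1 + 1 / (s / (d + 1))) ^ d, by positivity, fun x hx => ?_⟩
  calc (x + 1) ^ d ≤ ((1 + 1 / (s / (d + 1))) * Real.exp (s / (d + 1) * x)) ^ d :=
        pow_le_pow_left₀ (by positivity) (add_one_le_mul_exp hr hx) d
    _ = (1 + 1 / (s / (d + 1))) ^ d * Real.exp (d * (s / (d + 1) * x)) := by
        rw [mul_pow, ← Real.exp_nat_mul]
    _ ≤ _ := by
        refine mul_le_mul_of_nonneg_left (Real.exp_le_exp.2 ?_) (by positivity)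
        rw [← mul_assoc]
        refine mul_le_mul_of_nonneg_right ?_ hx
        rw [← mul_div_assoc, div_le_iff₀ (by positivity)]
        nlinarith

namespace Params

variable (P : Params)

/-- A constant in the bound on the number of samples per action. -/
noncomputable def sampleConst : ℝ :=
  18 * (1 + P.M) ^ 2 / ((1 - P.γ) ^ 4 * (1 - √P.γ) ^ 2) + 1

lemma sampleConst_pos : 0 < P.sampleConst := by
  have := P.one_sub_pos
  have : 0 < 1 - √P.γ := sub_pos.2 P.sqrt_lt_one
  unfold sampleConst
  positivity

lemma K_cast_pos : (0 : ℝ) < P.K := Nat.cast_pos.2 P.K_pos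

variable {P} {δ' ε : ℝ}

/-- The condition `m ≤ 1` lets the main term absorb the rounding of the ceiling. -/
lemma N_le (hl : 0 ≤ Real.log (2 * P.K / δ')) {m : ℝ} (hm : 0 < m) (hm1 : m ≤ 1) (hmε : m ≤ ε) :
    (P.N δ' ε : ℝ) ≤ P.sampleConst * (Real.log (2 * P.K / δ') + 1) / m ^ 2 := by
  have := P.one_sub_pos
  have : 0 < 1 - √P.γ := sub_pos.2 P.sqrt_lt_one
  have hε : 0 < ε := hm.trans_le hmε
  set ℓ := Real.log (2 * P.K / δ')
  unfold N sampleConst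
  set A := 18 * (1 + P.M) ^ 2 / ((1 - P.γ) ^ 4 * (1 - √P.γ) ^ 2)
  have hA : 0 ≤ A := by positivity
  refine (Nat.ceil_lt_add_one (by positivity)).le.trans ?_
  have h1 : A * (ℓ / ε ^ 2) ≤ A * (ℓ / m ^ 2) := by gcongr
  have h2 : m ^ 2 ≤ 1 := pow_le_one₀ hm.le hm1
  calc _ ≤ A * (ℓ / m ^ 2) + 1 := by linarith
    _ = (A * ℓ + m ^ 2) / m ^ 2 := by field_simp
    _ ≤ _ := by
      gcongr
      nlinarith

lemma le_relax {m : ℝ} (hε : 0 < ε) (hm : m ≤ ε) (hm1 : m ≤ 1) : m ≤ P.relax ε := by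
  unfold relax
  split_ifs with h
  · exact hm1.trans P.one_le_cap
  · have h0 : 0 < √P.γ := Real.sqrt_pos.2 (lt_of_le_of_ne P.γ_nonneg (Ne.symm h))
    rw [le_div_iff₀ h0]
    have := P.sqrt_lt_one
    nlinarith

lemma depth_anti {a b : ℝ} (ha : 0 < a) (hab : a ≤ b) : P.depth b ≤ P.depth a := by
  unfold depth
  split_ifs with hb hac hac
  · have hc := P.cap_pos
    have : 0 ≤ Real.log (1 / √P.γ) := by
      rcases eq_or_lt_of_le P.sqrt_nonneg with h | h
      · simp [← h]
      · exact Real.log_nonneg ((one_le_div h).2 P.sqrt_lt_one.le)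
    refine Nat.add_le_add_right (Nat.ceil_mono ?_) 1
    have hb0 : 0 < b := ha.trans_le hab
    gcongr
  · exact absurd (hab.trans_lt hb) hac
  · exact Nat.zero_le _
  · exact le_rfl

lemma callsV_add_one_of_kappa_le (hε : 0 < ε) (hc : ε < P.cap) (hk : P.kappa ≤ ε) :
    (P.callsV δ' ε + 1 : ℝ) = P.K * P.N δ' ε * (P.callsV δ' (P.relax ε) + 1) + 1 := by
  rw [callsV_of_kappa_le δ' hε hc hk, callsQ]
  push_cast
  ring

lemma callsV_add_one_of_lt_kappa (hε : 0 < ε) (hc : ε < P.cap) (hk : ε < P.kappa) :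
    (P.callsV δ' ε + 1 : ℝ) = P.K * P.N δ' √(P.kappa * ε) *
      (P.callsV δ' (P.relax √(P.kappa * ε)) + 1) + 1 + (P.callsV δ' (P.relax ε) + 1) := by
  rw [callsV_of_lt_kappa δ' hε hc hk, callsQ]
  push_cast
  ring

/-- One factor per level of the recursion: `K Y` for the samples, and `2` for the additive one and
the single linear call. -/
lemma callsV_add_one_le_pow {m : ℝ} (hm : 0 < m) (hm1 : m ≤ 1)
    (hl : 0 ≤ Real.log (2 * P.K / δ')) (hmε : m ≤ ε) :
    (P.callsV δ' ε + 1 : ℝ) ≤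
      (P.K * (P.sampleConst * (Real.log (2 * P.K / δ') + 1) / m ^ 2) + 2) ^ P.depth ε := by
  set Y := P.sampleConst * (Real.log (2 * P.K / δ') + 1) / m ^ 2 with hY
  have hK := P.K_cast_pos
  have hA := P.sampleConst_pos
  have hY0 : 0 ≤ Y := by positivity
  have hN : ∀ e, m ≤ e → (P.N δ' e : ℝ) ≤ Y := fun e he => N_le hl hm hm1 he
  have hX : 1 ≤ P.K * Y + 2 := by nlinarith
  have hstep : ∀ e, m ≤ e → ∀ k d, k < d → ∀ z : ℝ, 0 ≤ z → z ≤ (P.K * Y + 2) ^ k →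
      ∀ k' < d, ∀ z' : ℝ, z' ≤ (P.K * Y + 2) ^ k' →
        P.K * P.N δ' e * z + 1 + z' ≤ (P.K * Y + 2) ^ d := by
    intro e he k d hk z hz0 hz k' hk' z' hz'
    obtain ⟨d, rfl⟩ : ∃ d', d = d' + 1 := ⟨d - 1, by omega⟩
    have h1 : z ≤ (P.K * Y + 2) ^ d := hz.trans (pow_le_pow_right₀ hX (by omega))
    have h2 : z' ≤ (P.K * Y + 2) ^ d := hz'.trans (pow_le_pow_right₀ hX (by omega))
    have h3 : 1 ≤ (P.K * Y + 2) ^ d := one_le_pow₀ hX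
    have h4 : P.K * P.N δ' e * z ≤ P.K * Y * (P.K * Y + 2) ^ d := by
      have := hN e he
      gcongr
    rw [pow_succ']
    linarith
  refine P.accuracy_induction (p := fun ε => m ≤ ε →
    (P.callsV δ' ε + 1 : ℝ) ≤ (P.K * Y + 2) ^ P.depth ε)
    (fun ε hc hmε => ?_) (fun ε hε hc hk ih hmε => ?_) (fun ε hε hc hk ih ih' hmε => ?_)
    (hm.trans_le hmε) hmε
  · rw [callsV_of_cap_le δ' hc]
    simpa using one_le_pow₀ hX
  · rw [callsV_add_one_of_kappa_le hε hc hk]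
    have := hstep ε hmε _ _ (P.depth_lt hε hc le_rfl) _ (by positivity)
      (ih (le_relax hε hmε hm1)) _ (P.depth_lt hε hc le_rfl) 0 (by positivity)
    simpa using this
  · rw [callsV_add_one_of_lt_kappa hε hc hk]
    have he := P.le_sqrt_kappa hε hk
    have he0 := hε.trans_le he
    exact hstep _ (hmε.trans he) _ _ (P.depth_lt hε hc he) _ (by positivity)
      (ih (le_relax he0 (hmε.trans he) hm1)) _ (P.depth_lt hε hc le_rfl) _
      (ih' (le_relax hε hmε hm1))

/-- For accuracies at least `m` the depth is bounded, so the cost is at most polynomial in the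
logarithm. This is the base case of the bound by `growth`. -/
lemma exists_callsV_le_mul_exp (P : Params) {m η : ℝ} (hm : 0 < m) (hm1 : m ≤ 1) (hη : 0 < η) :
    ∃ D, 0 < D ∧ ∀ δ', 0 ≤ Real.log (2 * P.K / δ') → ∀ ε, m ≤ ε →
      (P.callsV δ' ε + 1 : ℝ) ≤ D * Real.exp (η * Real.log (2 * P.K / δ')) := by
  obtain ⟨D, hD, h⟩ := exists_add_one_pow_le_mul_exp hη (P.depth m)
  have hK := P.K_cast_pos
  have hA := P.sampleConst_pos
  set B := P.K * (P.sampleConst / m ^ 2) + 2 with hB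
  refine ⟨B ^ P.depth m * D, by positivity, fun δ' hl ε hε => ?_⟩
  refine (callsV_add_one_le_pow hm hm1 hl hε).trans ?_
  set ℓ := Real.log (2 * P.K / δ')
  have h1 : P.K * (P.sampleConst * (ℓ + 1) / m ^ 2) + 2 ≤ B * (ℓ + 1) := by
    have : B * (ℓ + 1) = P.K * (P.sampleConst * (ℓ + 1) / m ^ 2) + 2 * (ℓ + 1) := by
      rw [hB]; ring
    linarith
  have h2 : 1 ≤ B * (ℓ + 1) := by
    have : 2 ≤ B := by rw [hB]; have : 0 < P.K * (P.sampleConst / m ^ 2) := by positivity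
                       linarith
    nlinarith
  calc _ ≤ (B * (ℓ + 1)) ^ P.depth ε := pow_le_pow_left₀ (by positivity) h1 _
    _ ≤ (B * (ℓ + 1)) ^ P.depth m := pow_le_pow_right₀ h2 (depth_anti hm hε)
    _ = B ^ P.depth m * (ℓ + 1) ^ P.depth m := mul_pow _ _ _
    _ ≤ B ^ P.depth m * (D * Real.exp (η * ℓ)) := by
        have := h ℓ hl
        gcongr
    _ = _ := by ring

end Params

/-- The bound on the number of oracle calls of `sampleV` at accuracy `m ≤ 1`, up to a constant. -/
noncomputable def growth (c η ℓ m : ℝ) : ℝ :=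
  m ^ (-(2 + 2 * c)) * Real.exp (η * ℓ * (2 - m ^ (c / 2)))

/-! ### The majorant of the cost recursion -/

section Growth

variable {c η ℓ m : ℝ}

lemma growth_anti (hc : 0 < c) (hη : 0 < η) (hℓ : 0 ≤ ℓ) (hm : 0 < m) {m' : ℝ} (h : m ≤ m') :
    growth c η ℓ m' ≤ growth c η ℓ m := by
  unfold growth
  have h1 : m' ^ (-(2 + 2 * c)) ≤ m ^ (-(2 + 2 * c)) :=
    Real.rpow_le_rpow_of_nonpos hm h (by linarith)
  have h2 : m ^ (c / 2) ≤ m' ^ (c / 2) := Real.rpow_le_rpow hm.le h (by positivity)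
  have : 0 < m ^ (-(2 + 2 * c)) := Real.rpow_pos_of_pos hm _
  gcongr

lemma exp_le_growth (hc : 0 < c) (hη : 0 < η) (hℓ : 0 ≤ ℓ) (hm : 0 < m) (hm1 : m ≤ 1) :
    Real.exp (η * ℓ) ≤ growth c η ℓ m := by
  have := growth_anti hc hη hℓ hm hm1
  norm_num [growth] at this ⊢
  exact this

lemma growth_le (hη : 0 < η) (hℓ : 0 ≤ ℓ) (hm : 0 < m) :
    growth c η ℓ m ≤ m ^ (-(2 + 2 * c)) * Real.exp (2 * η * ℓ) := by
  unfold growth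
  have h1 : 0 < m ^ (c / 2) := Real.rpow_pos_of_pos hm _
  refine mul_le_mul_of_nonneg_left (Real.exp_le_exp.2 ?_) (Real.rpow_nonneg hm.le _)
  nlinarith [mul_nonneg (mul_nonneg hη.le hℓ) h1.le]

lemma growth_mul_le (hc : 0 < c) (hη : 0 < η) (hℓ : 0 ≤ ℓ) (hm : 0 < m) {r : ℝ} (hr : 1 ≤ r) :
    growth c η ℓ (r * m) ≤ r⁻¹ * growth c η ℓ m := by
  have hr0 : 0 < r := one_pos.trans_le hr
  unfold growth
  rw [Real.mul_rpow hr0.le hm.le, ← mul_assoc]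
  have h1 : r ^ (-(2 + 2 * c)) ≤ r⁻¹ := by
    rw [← Real.rpow_neg_one]
    exact Real.rpow_le_rpow_of_exponent_le hr (by linarith)
  have h2 : m ^ (c / 2) ≤ (r * m) ^ (c / 2) :=
    Real.rpow_le_rpow hm.le (by nlinarith) (by positivity)
  have : 0 < m ^ (-(2 + 2 * c)) := Real.rpow_pos_of_pos hm _
  gcongr

/-- Let `z = m ^ (c / 4)`. Up to constants, passing to `√(κ m)` and dividing by `m` gains `z⁴` from
the power and `exp (-η ℓ z²)` from the exponential. Since `(ℓ + 1) z²` is at most a constant times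
`exp (η ℓ z²)`, a factor `z²` remains, uniformly in `ℓ`. -/
lemma exists_growth_sqrt_le (hc : 0 < c) (hη : 0 < η) {κ θ B : ℝ} (hκ : 0 < κ) (hθ : 0 < θ)
    (hB : 0 ≤ B) : ∃ m₀, 0 < m₀ ∧ ∀ m, 0 < m → m < m₀ → ∀ ℓ, 0 ≤ ℓ →
      B * (ℓ + 1) / m * growth c η ℓ √(κ * m) ≤ θ * growth c η ℓ m := by
  have h4 : 0 < c / 4 := by positivity
  have hlim : Tendsto (fun m : ℝ => m ^ (c / 4)) (𝓝[>] 0) (𝓝 0) := by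
    have := (Real.continuousAt_rpow_const 0 (c / 4) (Or.inr h4.le)).tendsto
    rw [Real.zero_rpow h4.ne'] at this
    exact this.mono_left nhdsWithin_le_nhds
  set B' := B * κ ^ (-(1 + c)) * (1 + 1 / η) with hB'
  have hκc : 0 < κ ^ (-(1 + c)) := Real.rpow_pos_of_pos hκ _
  have hB0 : 0 ≤ B' := by positivity
  have hev : ∀ᶠ m : ℝ in 𝓝[>] 0, 2 * m ^ (c / 4) < κ ^ (c / 4) ∧
      B' * (m ^ (c / 4) * m ^ (c / 4)) < θ ∧ m < 1 := by
    refine ((hlim.const_mul 2).eventually_lt_const ?_).and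
      ((((hlim.mul hlim).const_mul B').eventually_lt_const ?_).and
        (eventually_nhdsWithin_of_eventually_nhds (eventually_lt_nhds one_pos)))
    · simpa using Real.rpow_pos_of_pos hκ _
    · simpa using hθ
  obtain ⟨m₀, hm₀, hsub⟩ := mem_nhdsGT_iff_exists_Ioo_subset.1 hev
  refine ⟨m₀, hm₀, fun m hm hlt ℓ hℓ => ?_⟩
  obtain ⟨h1, h2, h3⟩ := hsub ⟨hm, hlt⟩
  set z := m ^ (c / 4) with hz
  have hz0 : 0 < z := Real.rpow_pos_of_pos hm _
  have hz1 : z ≤ 1 := Real.rpow_le_one hm.le h3.le h4.le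
  have hzz : m ^ (c / 2) = z * z := by
    rw [hz, ← Real.rpow_add hm]; ring_nf
  have hsq : √(κ * m) ^ (c / 2) = κ ^ (c / 4) * z := by
    rw [Real.sqrt_eq_rpow, ← Real.rpow_mul (by positivity), Real.mul_rpow hκ.le hm.le, hz]
    ring_nf
  have hsp : √(κ * m) ^ (-(2 + 2 * c)) = κ ^ (-(1 + c)) * m ^ (-(1 + c)) := by
    rw [Real.sqrt_eq_rpow, ← Real.rpow_mul (by positivity), Real.mul_rpow hκ.le hm.le]
    ring_nf
  have hmp : m ^ (-(1 + c)) / m = m ^ (-(2 + 2 * c)) * (z * z * (z * z)) := by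
    rw [hz, div_eq_mul_inv, ← Real.rpow_neg_one m]
    simp only [← Real.rpow_add hm]
    ring_nf
  have hexp : Real.exp (η * ℓ * (2 - κ ^ (c / 4) * z)) ≤
      Real.exp (-(η * (ℓ * (z * z)))) * Real.exp (η * ℓ * (2 - z * z)) := by
    rw [← Real.exp_add]
    refine Real.exp_le_exp.2 ?_
    have h5 : 2 * z * z ≤ κ ^ (c / 4) * z := mul_le_mul_of_nonneg_right h1.le hz0.le
    nlinarith [mul_le_mul_of_nonneg_left h5 (mul_nonneg hη.le hℓ)]
  have hpoly : (ℓ + 1) * (z * z) ≤ (1 + 1 / η) * Real.exp (η * (ℓ * (z * z))) := by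
    refine le_trans ?_ (add_one_le_mul_exp hη (by positivity))
    have : z * z ≤ 1 := by nlinarith
    linarith
  have hpoly' : (ℓ + 1) * (z * z) * Real.exp (-(η * (ℓ * (z * z)))) ≤ 1 + 1 / η := by
    rw [Real.exp_neg, ← div_eq_mul_inv]
    exact (div_le_iff₀ (Real.exp_pos _)).2 hpoly
  have hmpos : 0 < m ^ (-(2 + 2 * c)) := Real.rpow_pos_of_pos hm _
  unfold growth
  rw [hsq, hsp, hzz]
  calc B * (ℓ + 1) / m * (κ ^ (-(1 + c)) * m ^ (-(1 + c))
        * Real.exp (η * ℓ * (2 - κ ^ (c / 4) * z)))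
      = B * κ ^ (-(1 + c)) * (ℓ + 1) * (m ^ (-(1 + c)) / m)
        * Real.exp (η * ℓ * (2 - κ ^ (c / 4) * z)) := by ring
    _ ≤ B * κ ^ (-(1 + c)) * (ℓ + 1) * (m ^ (-(1 + c)) / m)
        * (Real.exp (-(η * (ℓ * (z * z)))) * Real.exp (η * ℓ * (2 - z * z))) := by
        refine mul_le_mul_of_nonneg_left hexp ?_
        rw [hmp]
        positivity
    _ = B * κ ^ (-(1 + c)) * ((ℓ + 1) * (z * z) * Real.exp (-(η * (ℓ * (z * z))))) * (z * z)
        * (m ^ (-(2 + 2 * c)) * Real.exp (η * ℓ * (2 - z * z))) := by rw [hmp]; ring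
    _ ≤ B * κ ^ (-(1 + c)) * (1 + 1 / η) * (z * z)
        * (m ^ (-(2 + 2 * c)) * Real.exp (η * ℓ * (2 - z * z))) := by gcongr
    _ ≤ _ := mul_le_mul_of_nonneg_right h2.le (by positivity)

end Growth

namespace Params

/-- A factor above one by which the accuracy grows in a recursive call. -/
noncomputable def ratio (P : Params) : ℝ := 2 / (1 + √P.γ)

variable (P : Params)

lemma one_lt_ratio : 1 < P.ratio := by
  have := P.sqrt_lt_one
  have := P.sqrt_nonneg
  rw [ratio, one_lt_div (by linarith)]
  linarith

lemma ratio_le_two : P.ratio ≤ 2 := by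
  have := P.sqrt_nonneg
  exact div_le_self zero_le_two (by linarith)

lemma ratio_mul_le_relax {ε : ℝ} (hε : 0 < ε) (h : ε ≤ 1 / 2) : P.ratio * ε ≤ P.relax ε := by
  have h2 := P.ratio_le_two
  unfold relax
  split_ifs with hγ
  · have := P.one_le_cap
    nlinarith
  · have h0 : 0 < √P.γ := Real.sqrt_pos.2 (lt_of_le_of_ne P.γ_nonneg (Ne.symm hγ))
    have := P.sqrt_lt_one
    rw [ratio, div_mul_eq_mul_div, div_le_div_iff₀ (by linarith) h0]
    nlinarith

lemma exists_callsV_le_growth {c η : ℝ} (hc : 0 < c) (hη : 0 < η) :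
    ∃ D, 0 < D ∧ ∀ δ', 0 ≤ Real.log (2 * P.K / δ') → ∀ ε, 0 < ε →
      (P.callsV δ' ε + 1 : ℝ) ≤ D * growth c η (Real.log (2 * P.K / δ')) (min ε 1) := by
  have hκ := P.kappa_pos
  have hK := P.K_cast_pos
  have hA := P.sampleConst_pos
  have hρ := P.one_lt_ratio
  set ρ := P.ratio
  -- The linear call takes the fraction `ρ⁻¹` of the bound; the `estimateQ` call and the additive
  -- one share the rest, `θ` each.
  set θ := (1 - ρ⁻¹) / 2 with hθdef
  have hθ : 0 < θ := by
    have := inv_lt_one_of_one_lt₀ hρ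
    rw [hθdef]
    linarith
  obtain ⟨m₀, hm₀, hstep⟩ := exists_growth_sqrt_le hc hη hκ hθ
    (B := P.K * P.sampleConst / P.kappa) (by positivity)
  set m₁ := min (min m₀ P.kappa) (min (1 / 2) P.kappa⁻¹) with hm₁def
  have hm₁ : 0 < m₁ := by positivity
  have hm₁m₀ : m₁ ≤ m₀ := (min_le_left _ _).trans (min_le_left _ _)
  have hm₁κ : m₁ ≤ P.kappa := (min_le_left _ _).trans (min_le_right _ _)
  have hm₁h : m₁ ≤ 1 / 2 := (min_le_right _ _).trans (min_le_left _ _)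
  have hm₁i : m₁ ≤ P.kappa⁻¹ := (min_le_right _ _).trans (min_le_right _ _)
  obtain ⟨D₁, hD₁, hcrude⟩ := P.exists_callsV_le_mul_exp hm₁ (by linarith) hη
  -- `D₁` covers accuracies at least `m₁`; `θ⁻¹` makes `D θ ≥ 1`, which pays for the additive one.
  refine ⟨D₁ + θ⁻¹, by positivity, fun δ' hl => ?_⟩
  set ℓ := Real.log (2 * P.K / δ')
  set D := D₁ + θ⁻¹ with hDdef
  have hD : 0 < D := by positivity
  have hlarge : ∀ ε, 0 < ε → m₁ ≤ ε → (P.callsV δ' ε + 1 : ℝ) ≤ D * growth c η ℓ (min ε 1) := by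
    intro ε hε hm
    have h1 := exp_le_growth hc hη hl (lt_min hε one_pos) (min_le_right ε 1)
    have h2 : D₁ ≤ D := by rw [hDdef]; linarith [inv_pos.2 hθ]
    calc _ ≤ _ := hcrude δ' hl ε hm
      _ ≤ _ := by gcongr
  intro ε hε
  refine P.accuracy_induction
    (p := fun ε => (P.callsV δ' ε + 1 : ℝ) ≤ D * growth c η ℓ (min ε 1))
    (fun ε hcap => ?_) (fun ε hε hcap hk ih => ?_) (fun ε hε hcap hk ih ih' => ?_) hε
  · have := P.one_le_cap
    exact hlarge ε (by linarith) (by linarith)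
  · exact hlarge ε hε (hm₁κ.trans hk)
  rcases le_or_gt m₁ ε with hm | hm
  · exact hlarge ε hε hm
  have he0 : 0 < √(P.kappa * ε) := by positivity
  have he1 : √(P.kappa * ε) ≤ 1 := by
    refine Real.sqrt_le_one.2 ?_
    calc P.kappa * ε ≤ P.kappa * P.kappa⁻¹ := by gcongr; linarith
      _ = 1 := mul_inv_cancel₀ hκ.ne'
  rw [callsV_add_one_of_lt_kappa hε hcap hk, min_eq_left (by linarith : ε ≤ 1)]
  have h1 : (P.callsV δ' (P.relax ε) + 1 : ℝ) ≤ D * (ρ⁻¹ * growth c η ℓ ε) := by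
    refine ih'.trans (mul_le_mul_of_nonneg_left ?_ hD.le)
    refine (growth_anti hc hη hl (by positivity) (le_min ?_ ?_)).trans
      (growth_mul_le hc hη hl hε hρ.le)
    · exact P.ratio_mul_le_relax hε (by linarith)
    · have := P.ratio_le_two
      show P.ratio * ε ≤ 1
      nlinarith
  have h2 : (P.callsV δ' (P.relax √(P.kappa * ε)) + 1 : ℝ) ≤ D * growth c η ℓ √(P.kappa * ε) := by
    refine ih.trans (mul_le_mul_of_nonneg_left ?_ hD.le)
    exact growth_anti hc hη hl he0 (le_min (le_relax he0 le_rfl he1) he1)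
  have h3 := N_le (P := P) hl he0 he1 le_rfl
  rw [Real.sq_sqrt (by positivity)] at h3
  have h4 : P.K * P.N δ' √(P.kappa * ε) * (P.callsV δ' (P.relax √(P.kappa * ε)) + 1 : ℝ) ≤
      D * (θ * growth c η ℓ ε) := by
    calc _ ≤ P.K * (P.sampleConst * (ℓ + 1) / (P.kappa * ε)) *
          (D * growth c η ℓ √(P.kappa * ε)) := by gcongr
      _ = D * (P.K * P.sampleConst / P.kappa * (ℓ + 1) / ε * growth c η ℓ √(P.kappa * ε)) := by
          field_simp
      _ ≤ _ := mul_le_mul_of_nonneg_left (hstep ε hε (hm.trans_le hm₁m₀) ℓ hl) hD.le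
  have h5 : 1 ≤ D * (θ * growth c η ℓ ε) := by
    have h6 : 1 ≤ growth c η ℓ ε :=
      (Real.one_le_exp (by positivity)).trans (exp_le_growth hc hη hl hε (by linarith))
    have h7 : 1 ≤ D * θ := by
      rw [hDdef, add_mul, inv_mul_cancel₀ hθ.ne']
      have : 0 < D₁ * θ := by positivity
      linarith
    rw [← mul_assoc]
    nlinarith
  have h8 : D * (θ * growth c η ℓ ε) + D * (θ * growth c η ℓ ε) + D * (ρ⁻¹ * growth c η ℓ ε)
      = D * growth c η ℓ ε := by rw [hθdef]; ring
  linarith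

/-- The sample complexity, with arbitrarily small powers of `1 / ε` and `1 / δ'` in place of
logarithms. -/
lemma exists_calls_le {c η : ℝ} (hc : 0 < c) (hη : 0 < η) :
    ∃ D, 0 < D ∧ ∀ ε δ' : ℝ, 0 < ε → 0 < δ' → δ' < 2 * P.K →
      (P.calls ε δ' : ℝ) ≤ D * (2 * P.K / δ') ^ η * (min ε 1) ^ (-(4 + c)) := by
  -- The power is `2 + c` from `sampleV` and `2` from `N`. Of `η`, two thirds go to `growth` and one
  -- third to the logarithm in `N`.
  obtain ⟨D, hD, h⟩ := P.exists_callsV_le_growth (c := c / 2) (η := η / 3) (by positivity)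
    (by positivity)
  have hK := P.K_cast_pos
  have hA := P.sampleConst_pos
  refine ⟨P.K * P.sampleConst * (1 + 1 / (η / 3)) * D, by positivity,
    fun ε δ' hε hδ hδ' => ?_⟩
  have hl := (log_pos (P := P) hδ hδ').le
  have hm : 0 < min ε 1 := lt_min hε one_pos
  have hm1 : min ε 1 ≤ 1 := min_le_right _ _
  rw [Real.rpow_def_of_pos (by positivity), calls, callsQ]
  have h1 := h δ' hl (P.relax ε) (P.relax_pos hε)
  have h2 := growth_anti (c := c / 2) (η := η / 3) (by positivity) (by positivity) hl hm
    (le_min (le_relax (P := P) hε (min_le_left ε 1) hm1) hm1)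
  have h3 := growth_le (c := c / 2) (η := η / 3) (by positivity) hl hm
  have h4 := N_le (P := P) hl hm hm1 (min_le_left ε 1)
  have h5 := add_one_le_mul_exp (s := η / 3) (by positivity) hl
  set ℓ := Real.log (2 * P.K / δ')
  set m := min ε 1
  have h6 : m ^ (-(2 + 2 * (c / 2))) / m ^ 2 = m ^ (-(4 + c)) := by
    rw [← Real.rpow_natCast m 2, ← Real.rpow_sub hm]
    norm_num
    ring_nf
  have h7 : Real.exp (η / 3 * ℓ) * Real.exp (2 * (η / 3) * ℓ) = Real.exp (ℓ * η) := by
    rw [← Real.exp_add]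
    ring_nf
  have h8 : (P.callsV δ' (P.relax ε) + 1 : ℝ) ≤
      D * (m ^ (-(2 + 2 * (c / 2))) * Real.exp (2 * (η / 3) * ℓ)) :=
    h1.trans (mul_le_mul_of_nonneg_left (h2.trans h3) hD.le)
  have hmp : 0 < m ^ (-(2 + 2 * (c / 2))) := Real.rpow_pos_of_pos hm _
  push_cast
  calc _ ≤ P.K * (P.sampleConst * ((1 + 1 / (η / 3)) * Real.exp (η / 3 * ℓ)) / m ^ 2) *
        (D * (m ^ (-(2 + 2 * (c / 2))) * Real.exp (2 * (η / 3) * ℓ))) := by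
        have h9 : (P.N δ' ε : ℝ) ≤
            P.sampleConst * ((1 + 1 / (η / 3)) * Real.exp (η / 3 * ℓ)) / m ^ 2 :=
          h4.trans (by gcongr)
        gcongr
    _ = P.K * P.sampleConst * (1 + 1 / (η / 3)) * D *
        (Real.exp (η / 3 * ℓ) * Real.exp (2 * (η / 3) * ℓ)) *
        (m ^ (-(2 + 2 * (c / 2))) / m ^ 2) := by ring
    _ = _ := by rw [h6, h7]

end Params

/-! ### Choice of the confidence parameter and the theorem -/

namespace Params

/-- Confidence parameters for which the failure probability is at most `δ`, while the number of
oracle calls is of order `4 + c` for all `c > 0`. -/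
lemma exists_confidence (P : Params) : ∃ d : ℝ → ℝ → ℝ,
    (∀ ε δ : ℝ, 0 < ε → 0 < δ → 0 < d ε δ ∧ d ε δ < 2 * P.K ∧ d ε δ * P.calls ε (d ε δ) ≤ δ) ∧
    ∀ δ : ℝ, 0 < δ → ∀ c : ℝ, 0 < c →
      (fun ε : ℝ => (P.calls ε (d ε δ) : ℝ)) =O[𝓝[>] 0] fun ε : ℝ => 1 / ε ^ (4 + c) := by
  obtain ⟨D₁, hD₁, h₁⟩ := P.exists_calls_le (c := 2) (η := 1 / 2) (by norm_num) (by norm_num)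
  have hK := P.K_cast_pos
  have hK1 : (1 : ℝ) ≤ P.K := Nat.one_le_cast.2 P.K_pos
  -- With `m = min ε 1`, the bound above gives `x * calls ≤ D₁ m⁻⁶ √(2 K x)`; the second entry
  -- solves for this to equal `δ`. The choice does not involve the later `c`.
  set d : ℝ → ℝ → ℝ := fun ε δ => min 1 ((δ * (min ε 1) ^ 6 / D₁) ^ 2 / (2 * P.K)) with hd
  have hpos : ∀ ε δ : ℝ, 0 < ε → 0 < δ → 0 < d ε δ := fun ε δ hε hδ => by
    have : 0 < min ε 1 := lt_min hε one_pos
    exact lt_min one_pos (by positivity)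
  have hlt : ∀ ε δ : ℝ, d ε δ < 2 * P.K := fun ε δ =>
    (min_le_left _ _).trans_lt (by linarith)
  refine ⟨d, fun ε δ hε hδ => ⟨hpos ε δ hε hδ, hlt ε δ, ?_⟩, fun δ hδ c hc => ?_⟩
  · have hd0 := hpos ε δ hε hδ
    have hm : 0 < min ε 1 := lt_min hε one_pos
    have hle : d ε δ ≤ (δ * (min ε 1) ^ 6 / D₁) ^ 2 / (2 * P.K) := min_le_right _ _
    have hc := h₁ ε (d ε δ) hε hd0 (hlt ε δ)
    set m := min ε 1
    set x := d ε δ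
    rw [← Real.sqrt_eq_rpow, show (-(4 + 2) : ℝ) = -((6 : ℕ) : ℝ) by norm_num,
      Real.rpow_neg hm.le, Real.rpow_natCast] at hc
    have h2 : x * √(2 * P.K / x) = √(2 * P.K * x) := by
      rw [← Real.sqrt_sq hd0.le, ← Real.sqrt_mul (sq_nonneg x), Real.sqrt_sq hd0.le]
      congr 1
      field_simp
    have h3 : √(2 * P.K * x) ≤ δ * m ^ 6 / D₁ := by
      rw [Real.sqrt_le_left (by positivity)]
      rw [le_div_iff₀ (by positivity)] at hle
      linarith
    calc x * P.calls ε x ≤ x * (D₁ * √(2 * P.K / x) * (m ^ 6)⁻¹) :=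
          mul_le_mul_of_nonneg_left hc hd0.le
      _ = D₁ * (m ^ 6)⁻¹ * (x * √(2 * P.K / x)) := by ring
      _ ≤ D₁ * (m ^ 6)⁻¹ * (δ * m ^ 6 / D₁) := by
          rw [h2]
          exact mul_le_mul_of_nonneg_left h3 (by positivity)
      _ = δ := by field_simp
  -- As `d ε δ` is at least of order `ε ^ 12`, the power `c / 24` of its inverse costs `ε ^ (-c /
  -- 2)`, the other half of `c`.
  · obtain ⟨D, hD, h⟩ := P.exists_calls_le (c := c / 2) (η := c / 24) (by positivity)
      (by positivity)
    set k := min 1 ((δ / D₁) ^ 2 / (2 * P.K)) with hk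
    have hk0 : 0 < k := lt_min one_pos (by positivity)
    refine IsBigO.of_bound (D * (2 * P.K / k) ^ (c / 24)) ?_
    filter_upwards [self_mem_nhdsWithin,
      eventually_nhdsWithin_of_eventually_nhds (eventually_lt_nhds one_pos)] with ε hε hε1
    replace hε : 0 < ε := hε
    have hm : min ε 1 = ε := min_eq_left hε1.le
    have hd0 := hpos ε δ hε hδ
    have hkd : k * ε ^ 12 ≤ d ε δ := by
      have h12 : ε ^ 12 ≤ 1 := pow_le_one₀ hε.le hε1.le
      simp only [hd, hm]
      refine le_min ?_ ?_
      · have := min_le_left 1 ((δ / D₁) ^ 2 / (2 * P.K))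
        calc k * ε ^ 12 ≤ 1 * 1 := by gcongr
          _ = 1 := one_mul 1
      · calc k * ε ^ 12 ≤ (δ / D₁) ^ 2 / (2 * P.K) * ε ^ 12 :=
            mul_le_mul_of_nonneg_right (min_le_right _ _) (by positivity)
          _ = _ := by ring
    have hc := h ε (d ε δ) hε hd0 (hlt ε δ)
    rw [hm] at hc
    have h2 : (2 * P.K / d ε δ) ^ (c / 24) ≤ (2 * P.K / k) ^ (c / 24) * ε ^ (-(c / 2)) := by
      calc (2 * P.K / d ε δ) ^ (c / 24) ≤ (2 * P.K / (k * ε ^ 12)) ^ (c / 24) := by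
            refine Real.rpow_le_rpow (by positivity) ?_ (by positivity)
            gcongr
        _ = (2 * P.K / k) ^ (c / 24) * ((ε ^ 12)⁻¹) ^ (c / 24) := by
            rw [← Real.mul_rpow (by positivity) (by positivity)]
            congr 1
            field_simp
        _ = _ := by
            congr 1
            rw [← Real.rpow_natCast ε 12, ← Real.rpow_neg hε.le, ← Real.rpow_mul hε.le]
            congr 1
            push_cast
            ring
    have h3 : ε ^ (-(c / 2)) * ε ^ (-(4 + c / 2)) = 1 / ε ^ (4 + c) := by
      rw [← Real.rpow_add hε, one_div, ← Real.rpow_neg hε.le]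
      congr 1
      ring
    have hεc : 0 < ε ^ (4 + c) := Real.rpow_pos_of_pos hε _
    have hεm : 0 < ε ^ (-(4 + c / 2)) := Real.rpow_pos_of_pos hε _
    rw [Real.norm_of_nonneg (Nat.cast_nonneg _), Real.norm_of_nonneg (by positivity)]
    calc _ ≤ _ := hc
      _ ≤ D * ((2 * P.K / k) ^ (c / 24) * ε ^ (-(c / 2))) * ε ^ (-(4 + c / 2)) := by gcongr
      _ = _ := by rw [← h3]; ring

end Params

theorem theorem2 (P : Params) :
    -- every covered problem has exactly one value function
    (∀ (S : Type u) [MeasurableSpace S] (E : Env S P.K), E.Admissible P → ∃! V, E.IsValue P.γ V) ∧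
    -- `n ε δ'` is the sample complexity, which is deterministic and independent of the problem
    ∃ n : ℝ → ℝ → ℕ,
      (∀ (S : Type u) [MeasurableSpace S] (E : Env S P.K) (V : S → ℝ) (lo : ℝ),
        E.Admissible P → E.IsValue P.γ V → E.ClipLevel P V lo →
        ∀ (s : S) (ε δ' : ℝ), 0 < ε → 0 < δ' →
          IsProbabilityMeasure (Env.smoothCruiser P E lo δ' ε s) ∧
          (∀ᵐ o ∂(Env.smoothCruiser P E lo δ' ε s), o.2 = n ε δ') ∧
          (δ' < 2 * P.K →
            Env.smoothCruiser P E lo δ' ε s {o | ε < |o.1 - V s|} ≤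
              ENNReal.ofReal (δ' * n ε δ'))) ∧
      ∃ δ' : ℝ → ℝ → ℝ,
        (∀ ε δ : ℝ, 0 < ε → 0 < δ → 0 < δ' ε δ ∧
          ∀ (S : Type u) [MeasurableSpace S] (E : Env S P.K) (V : S → ℝ) (lo : ℝ),
            E.Admissible P → E.IsValue P.γ V → E.ClipLevel P V lo →
            ∀ s : S, Env.smoothCruiser P E lo (δ' ε δ) ε s {o | ε < |o.1 - V s|} ≤
              ENNReal.ofReal δ) ∧
        ∀ δ : ℝ, 0 < δ → ∀ c : ℝ, 0 < c →
          (fun ε : ℝ => (n ε (δ' ε δ) : ℝ)) =O[𝓝[>] 0] fun ε : ℝ => 1 / ε ^ (4 + c) := by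
  refine ⟨fun S _ E h => ?_, P.calls, fun S _ E V lo h hV hlo s ε δ' hε hδ => ?_, ?_⟩
  · obtain ⟨V, hV⟩ := Env.exists_isValue h.isSmooth
    exact ⟨V, hV, fun W hW => hW.unique h.isSmooth hV⟩
  · have := h.isSmooth.isMarkovKernel_draw
    have := E.isMarkovKernel_smoothCruiser lo δ' hε
    exact ⟨inferInstance, E.ae_smoothCruiser_calls lo δ' hε s, fun hδ' =>
      Env.smoothCruiser_error_le h.isSmooth hV hlo hδ hδ' hε s⟩
  · obtain ⟨d, hd, hO⟩ := P.exists_confidence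
    refine ⟨d, fun ε δ hε hδ => ?_, hO⟩
    obtain ⟨h0, h1, h2⟩ := hd ε δ hε hδ
    exact ⟨h0, fun S _ E V lo h hV hlo s =>
      (Env.smoothCruiser_error_le h.isSmooth hV hlo h0 h1 hε s).trans
        (ENNReal.ofReal_le_ofReal h2)⟩
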